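/- Define graphs $D_n$ and $L_n$ ($n\ge 0$) recursively. Both $D_0$ and $L_0$ consist of two vertices joined by an edge. The graph $D_n$ is obtained from $D_{n-1}$ by replacing each edge $uv$ by a quadrilateral $u,a,v,b$ with edges $ua$, $av$, $vb$, $bu$, where $a,b$ are new vertices (different ones for different edges). The graph $L_n$ is obtained from $L_{n-1}$ by replacing each edge $uv$ by the graph with vertices $u,p,a,b,q,v$ and edges $up$, $pa$, $pb$, $aq$, $bq$, $qv$, where $p,a,b,q$ are new vertices (different ones for different edges). Give each edge of $D_n$ length $2^{-n}$ and each edge of $L_n$ length $4^{-n}$, and endow the vertex sets of $D_n$ and $L_n$ with the resulting shortest path metrics. Then the identity maps $D_{n-1}\to D_n$ and $L_{n-1}\to L_n$ of vertex sets are isometric embeddings. Let the infinite diamond $D_\omega$ be the union of the vertex sets of all $D_n$, and the Laakso space $L_\omega$ the union of the vertex sets of all $L_n$, each with the metric induced from the metrics of the graphs. Then $L_\omega$ admits no bilipschitz embedding into $D_\omega$; that is, there are no map $f:L_\omega\to D_\omega$ and real numbers $r>0$ and $C\ge 1$ such that \[ r\,d_{L_\omega}(u,v)\le d_{D_\omega}(f(u),f(v))\le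 rC\,d_{L_\omega}(u,v)\qquad\text{for all }u,v\in L_\omega. \] -/

import Mathlib

/-! ### Connected graphs and the operation "replace every edge" -/

/-- A connected simple graph (in particular with at least one vertex). -/
structure ConnectedGraph where
  V : Type
  G : SimpleGraph V
  conn : G.Connected

/-- The graph with two vertices joined by an edge. -/
def singleEdge : ConnectedGraph where
  V := Bool
  G := ⊤
  conn := SimpleGraph.connected_top

/-- A function on the vertices that grows by at most `1` along edges grows by at most the length
along walks. -/
theorem SimpleGraph.Walk.le_add_length_of_adj_le {V : Type} {G : SimpleGraph V} (φ : V → ℕ)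
    (h : ∀ x y, G.Adj x y → φ y ≤ φ x + 1) :
    ∀ {u v : V} (p : G.Walk u v), φ v ≤ φ u + p.length
  | _, _, .nil => by simp
  | _, _, .cons (v := w) a p => by
      have h1 := h _ _ a
      have h2 := le_add_length_of_adj_le φ h p
      rw [SimpleGraph.Walk.length_cons]
      omega

/-! ### Diamond graphs -/

/-- Vertices of the graph in which every edge `uv` of `G` is replaced by a quadrilateral
`u, a, v, b`: the old vertices, and two new vertices for each edge. -/
inductive DiamondVertex {V : Type} (G : SimpleGraph V) : Type
  | old (v : V)
  | mid (e : G.edgeSet) (side : Bool)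

/-- Every edge `uv` of `G` is replaced by a quadrilateral `u, a, v, b` with edges
`ua`, `av`, `vb`, `bu`. -/
def diamondReplace {V : Type} (G : SimpleGraph V) : SimpleGraph (DiamondVertex G) where
  Adj
    | .old v, .mid e _ => v ∈ e.1
    | .mid e _, .old v => v ∈ e.1
    | .old _, .old _ => False
    | .mid _ _, .mid _ _ => False
  symm := ⟨by rintro (_ | _) (_ | _) h <;> exact h⟩
  loopless := ⟨by rintro (_ | _) h <;> exact h⟩

/-! ### Laakso graphs -/

/-- Vertices of the graph in which every edge `uv` of `G` is replaced by the six-vertex graph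
`u - p`, `p - a`, `p - b`, `a - q`, `b - q`, `q - v`: the old vertices; for each edge with a chosen
direction the new vertex next to its starting point (`p` for `(u, v)`, `q` for `(v, u)`); and two
middle vertices `a`, `b` for each edge. -/
inductive LaaksoVertex {V : Type} (G : SimpleGraph V) : Type
  | old (v : V)
  | near (d : G.Dart)
  | mid (e : G.edgeSet) (side : Bool)

/-- Every edge `uv` of `G` is replaced by the graph with vertices `u, p, a, b, q, v` and edges
`up`, `pa`, `pb`, `aq`, `bq`, `qv`. -/
def laaksoReplace {V : Type} (G : SimpleGraph V) : SimpleGraph (LaaksoVertex G) where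
  Adj
    | .old v, .near d => d.fst = v
    | .near d, .old v => d.fst = v
    | .near d, .mid e _ => d.edge = e.1
    | .mid e _, .near d => d.edge = e.1
    | .old _, .old _ => False
    | .old _, .mid _ _ => False
    | .mid _ _, .old _ => False
    | .near _, .near _ => False
    | .mid _ _, .mid _ _ => False
  symm := ⟨by rintro (_ | _ | _) (_ | _ | _) h <;> exact h⟩
  loopless := ⟨by rintro (_ | _ | _) h <;> exact h⟩

/-! ### The replacements keep connectedness and multiply distances by `2`, resp. `4` -/

theorem diamondReplace_exists_walk {V : Type} {G : SimpleGraph V} :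
    ∀ {u v : V} (p : G.Walk u v),
      ∃ q : (diamondReplace G).Walk (.old u) (.old v), q.length = 2 * p.length
  | _, _, .nil => ⟨.nil, rfl⟩
  | u, _, .cons (v := w) a p => by
      obtain ⟨q, hq⟩ := diamondReplace_exists_walk p
      have h1 : (diamondReplace G).Adj (.old u) (.mid ⟨s(u, w), a⟩ true) :=
        Sym2.mem_mk_left u w
      have h2 : (diamondReplace G).Adj (.mid ⟨s(u, w), a⟩ true) (.old w) :=
        Sym2.mem_mk_right u w
      exact ⟨.cons h1 (.cons h2 q), by simp [hq]; omega⟩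

theorem laaksoReplace_exists_walk {V : Type} {G : SimpleGraph V} :
    ∀ {u v : V} (p : G.Walk u v),
      ∃ q : (laaksoReplace G).Walk (.old u) (.old v), q.length = 4 * p.length
  | _, _, .nil => ⟨.nil, rfl⟩
  | u, _, .cons (v := w) a p => by
      obtain ⟨q, hq⟩ := laaksoReplace_exists_walk p
      have h1 : (laaksoReplace G).Adj (.old u) (.near ⟨(u, w), a⟩) := rfl
      have h2 : (laaksoReplace G).Adj (.near ⟨(u, w), a⟩) (.mid ⟨s(u, w), a⟩ true) := rfl
      have h3 : (laaksoReplace G).Adj (.mid ⟨s(u, w), a⟩ true) (.near ⟨(w, u), a.symm⟩) :=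
        Sym2.eq_swap
      have h4 : (laaksoReplace G).Adj (.near ⟨(w, u), a.symm⟩) (.old w) := rfl
      exact ⟨.cons h1 (.cons h2 (.cons h3 (.cons h4 q))), by simp [hq]; omega⟩

theorem diamondReplace_connected {V : Type} {G : SimpleGraph V} (hG : G.Connected) :
    (diamondReplace G).Connected := by
  obtain ⟨v₀⟩ := hG.nonempty
  rw [SimpleGraph.connected_iff_exists_forall_reachable]
  have hold : ∀ w, (diamondReplace G).Reachable (.old v₀) (.old w) := fun w => by
    obtain ⟨p⟩ := hG.preconnected v₀ w
    exact ⟨(diamondReplace_exists_walk p).choose⟩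
  refine ⟨.old v₀, ?_⟩
  rintro (w | ⟨⟨e, he⟩, b⟩)
  · exact hold w
  · induction e with
    | h x y =>
      have h : (diamondReplace G).Adj (.old x) (.mid ⟨s(x, y), he⟩ b) := Sym2.mem_mk_left x y
      exact (hold x).trans h.reachable

theorem laaksoReplace_connected {V : Type} {G : SimpleGraph V} (hG : G.Connected) :
    (laaksoReplace G).Connected := by
  obtain ⟨v₀⟩ := hG.nonempty
  rw [SimpleGraph.connected_iff_exists_forall_reachable]
  have hold : ∀ w, (laaksoReplace G).Reachable (.old v₀) (.old w) := fun w => by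
    obtain ⟨p⟩ := hG.preconnected v₀ w
    exact ⟨(laaksoReplace_exists_walk p).choose⟩
  have hnear : ∀ d, (laaksoReplace G).Reachable (.old v₀) (.near d) := fun d => by
    have h : (laaksoReplace G).Adj (.old d.fst) (.near d) := rfl
    exact (hold d.fst).trans h.reachable
  refine ⟨.old v₀, ?_⟩
  rintro (w | d | ⟨⟨e, he⟩, b⟩)
  · exact hold w
  · exact hnear d
  · induction e with
    | h x y =>
      have h : (laaksoReplace G).Adj (.near ⟨(x, y), he⟩) (.mid ⟨s(x, y), he⟩ b) := rfl
      exact (hnear _).trans h.reachable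

theorem SimpleGraph.Connected.dist_le_dist_add_one {V : Type} {G : SimpleGraph V}
    (hG : G.Connected) (u : V) {x y : V} (h : G.Adj x y) : G.dist u y ≤ G.dist u x + 1 := by
  have := hG.dist_triangle (u := u) (v := x) (w := y)
  rwa [SimpleGraph.dist_eq_one_iff_adj.2 h] at this

theorem diamondReplace_dist {V : Type} {G : SimpleGraph V} (hG : G.Connected) (u v : V) :
    (diamondReplace G).dist (.old u) (.old v) = 2 * G.dist u v := by
  apply le_antisymm
  · obtain ⟨p, hp⟩ := hG.exists_walk_length_eq_dist u v
    obtain ⟨q, hq⟩ := diamondReplace_exists_walk p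
    rw [← hp, ← hq]
    exact SimpleGraph.dist_le q
  · obtain ⟨p, hp⟩ := (diamondReplace_connected hG).exists_walk_length_eq_dist (.old u) (.old v)
    rw [← hp]
    let m : Sym2 V → ℕ := Sym2.lift ⟨fun x y => min (2 * G.dist u x) (2 * G.dist u y) + 1,
      fun x y => by simp only [min_comm]⟩
    let φ : DiamondVertex G → ℕ
      | .old w => 2 * G.dist u w
      | .mid e _ => m e.1
    have key := p.le_add_length_of_adj_le φ (by
      have hm : ∀ (e : Sym2 V), e ∈ G.edgeSet → ∀ w ∈ e,
          m e ≤ 2 * G.dist u w + 1 ∧ 2 * G.dist u w ≤ m e + 1 := by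
        intro e
        induction e with
        | h x y =>
          intro he w hw
          have h1 := hG.dist_le_dist_add_one u (G.mem_edgeSet.1 he)
          have h2 := hG.dist_le_dist_add_one u (G.mem_edgeSet.1 he).symm
          change min (2 * G.dist u x) (2 * G.dist u y) + 1 ≤ 2 * G.dist u w + 1 ∧
            2 * G.dist u w ≤ min (2 * G.dist u x) (2 * G.dist u y) + 1 + 1
          rcases Sym2.mem_iff.1 hw with rfl | rfl <;> omega
      rintro (w | ⟨e, b⟩) (w' | ⟨e', b'⟩) h
      · exact h.elim
      · exact (hm e'.1 e'.2 w h).1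
      · exact (hm e.1 e.2 w' h).2
      · exact h.elim)
    simpa [φ] using key

theorem laaksoReplace_dist {V : Type} {G : SimpleGraph V} (hG : G.Connected) (u v : V) :
    (laaksoReplace G).dist (.old u) (.old v) = 4 * G.dist u v := by
  apply le_antisymm
  · obtain ⟨p, hp⟩ := hG.exists_walk_length_eq_dist u v
    obtain ⟨q, hq⟩ := laaksoReplace_exists_walk p
    rw [← hp, ← hq]
    exact SimpleGraph.dist_le q
  · obtain ⟨p, hp⟩ := (laaksoReplace_connected hG).exists_walk_length_eq_dist (.old u) (.old v)
    rw [← hp]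
    let m : Sym2 V → ℕ := Sym2.lift ⟨fun x y => min (4 * G.dist u x) (4 * G.dist u y) + 2,
      fun x y => by simp only [min_comm]⟩
    let φ : LaaksoVertex G → ℕ
      | .old w => 4 * G.dist u w
      | .near d => min (4 * G.dist u d.fst + 1) (4 * G.dist u d.snd + 3)
      | .mid e _ => m e.1
    have key := p.le_add_length_of_adj_le φ (by
      have hd : ∀ d : G.Dart, φ (.near d) ≤ 4 * G.dist u d.fst + 1 ∧
          4 * G.dist u d.fst ≤ φ (.near d) + 1 ∧
          φ (.near d) ≤ m d.edge + 1 ∧ m d.edge ≤ φ (.near d) + 1 := by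
        intro d
        have h1 := hG.dist_le_dist_add_one u d.adj
        have h2 := hG.dist_le_dist_add_one u d.adj.symm
        have hm : m d.edge = min (4 * G.dist u d.fst) (4 * G.dist u d.snd) + 2 := rfl
        have hn : φ (.near d) = min (4 * G.dist u d.fst + 1) (4 * G.dist u d.snd + 3) := rfl
        omega
      rintro (w | d | ⟨e, b⟩) (w' | d' | ⟨e', b'⟩) h
      · exact h.elim
      · cases (show d'.fst = w from h)
        exact (hd d').1
      · exact h.elim
      · cases (show d.fst = w' from h)
        exact (hd d).2.1
      · exact h.elim
      · change m e'.1 ≤ _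
        rw [← (show d.edge = e'.1 from h)]
        exact (hd d).2.2.2
      · exact h.elim
      · change _ ≤ m e.1 + 1
        rw [← (show d'.edge = e.1 from h)]
        exact (hd d').2.2.1
      · exact h.elim)
    simpa [φ] using key

/-! ### The sequences of weighted graphs as metric spaces -/

/-- The diamond graphs `D_n`. -/
def diamondGraph : ℕ → ConnectedGraph
  | 0 => singleEdge
  | n + 1 => ⟨DiamondVertex (diamondGraph n).G, diamondReplace (diamondGraph n).G,
      diamondReplace_connected (diamondGraph n).conn⟩

/-- The Laakso graphs `L_n`. -/
def laaksoGraph : ℕ → ConnectedGraph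
  | 0 => singleEdge
  | n + 1 => ⟨LaaksoVertex (laaksoGraph n).G, laaksoReplace (laaksoGraph n).G,
      laaksoReplace_connected (laaksoGraph n).conn⟩

/-- The shortest path metric on the vertices of a connected graph all of whose edges have the same
length `ℓ > 0`. -/
noncomputable abbrev ConnectedGraph.weightedMetric (H : ConnectedGraph) (ℓ : ℝ) (hℓ : 0 < ℓ) :
    MetricSpace H.V where
  dist u v := ℓ * (H.G.dist u v : ℝ)
  dist_self u := by simp
  dist_comm u v := by rw [SimpleGraph.dist_comm]
  dist_triangle u v w := by
    rw [← mul_add]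
    exact mul_le_mul_of_nonneg_left (by exact_mod_cast H.conn.dist_triangle) hℓ.le
  eq_of_dist_eq_zero {u v} h := by
    have h' : (H.G.dist u v : ℝ) = 0 := (mul_eq_zero.1 h).resolve_left hℓ.ne'
    exact H.conn.dist_eq_zero_iff.1 (by exact_mod_cast h')

/-- The vertex set of the diamond graph `D_n`. -/
def Diamond (n : ℕ) : Type := (diamondGraph n).V

/-- The vertex set of the Laakso graph `L_n`. -/
def Laakso (n : ℕ) : Type := (laaksoGraph n).V

/-- Weighted diamonds: each edge of `D_n` has length `2⁻ⁿ`. -/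
noncomputable instance (n : ℕ) : MetricSpace (Diamond n) :=
  (diamondGraph n).weightedMetric ((2 : ℝ)⁻¹ ^ n) (by positivity)

/-- Weighted Laakso graphs: each edge of `L_n` has length `4⁻ⁿ`. -/
noncomputable instance (n : ℕ) : MetricSpace (Laakso n) :=
  (laaksoGraph n).weightedMetric ((4 : ℝ)⁻¹ ^ n) (by positivity)

/-- The identity map of `D_n` into `D_{n+1}`. -/
def Diamond.incl (n : ℕ) (v : Diamond n) : Diamond (n + 1) :=
  DiamondVertex.old (G := (diamondGraph n).G) v

/-- The identity map of `L_n` into `L_{n+1}`. -/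
def Laakso.incl (n : ℕ) (v : Laakso n) : Laakso (n + 1) :=
  LaaksoVertex.old (G := (laaksoGraph n).G) v

theorem Diamond.isometry_incl (n : ℕ) : Isometry (Diamond.incl n) := by
  have key : ∀ u v : (diamondGraph n).V, (2 : ℝ)⁻¹ ^ (n + 1) *
      (((diamondReplace (diamondGraph n).G).dist (.old u) (.old v) : ℕ) : ℝ) =
      (2 : ℝ)⁻¹ ^ n * ((diamondGraph n).G.dist u v : ℝ) := fun u v => by
    rw [diamondReplace_dist (diamondGraph n).conn]
    push_cast
    ring
  exact Isometry.of_dist_eq key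

theorem Laakso.isometry_incl (n : ℕ) : Isometry (Laakso.incl n) := by
  have key : ∀ u v : (laaksoGraph n).V, (4 : ℝ)⁻¹ ^ (n + 1) *
      (((laaksoReplace (laaksoGraph n).G).dist (.old u) (.old v) : ℕ) : ℝ) =
      (4 : ℝ)⁻¹ ^ n * ((laaksoGraph n).G.dist u v : ℝ) := fun u v => by
    rw [laaksoReplace_dist (laaksoGraph n).conn]
    push_cast
    ring
  exact Isometry.of_dist_eq key

/-! ### The infinite diamond and the Laakso space -/

/-- The infinite diamond `D_ω`: the increasing union of the metric spaces `D_n` along the isometric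
identity maps `D_n → D_{n+1}`, with the induced metric (Mathlib's metric inductive limit, which
is not completed). -/
abbrev InfiniteDiamond : Type := Metric.InductiveLimit Diamond.isometry_incl

/-- The Laakso space `L_ω`: the increasing union of the metric spaces `L_n` along the isometric
identity maps `L_n → L_{n+1}`, with the induced metric. -/
abbrev LaaksoSpace : Type := Metric.InductiveLimit Laakso.isometry_incl

/-! ### Bilipschitz embeddings -/

/-- `f` is a `C`-bilipschitz embedding. -/
def IsBilipschitzEmbeddingWith {A Y : Type*} [MetricSpace A] [MetricSpace Y] (C : ℝ)
    (f : A → Y) : Prop :=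
  ∃ r : ℝ, 0 < r ∧ ∀ u v : A, r * dist u v ≤ dist (f u) (f v) ∧ dist (f u) (f v) ≤ r * C * dist u v

/-- `f` is a bilipschitz embedding: it is a `C`-bilipschitz embedding for some `1 ≤ C < ∞`. -/
def IsBilipschitzEmbedding {A Y : Type*} [MetricSpace A] [MetricSpace Y] (f : A → Y) : Prop :=
  ∃ C : ℝ, 1 ≤ C ∧ IsBilipschitzEmbeddingWith C f

/-! Let `K` be the least Lipschitz constant of a bilipschitz map `f`. It is the supremum of the
stretch of `f` over the edges of all levels of the Laakso space, so some edge is stretched by almost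
`K`. The proof derives a contradiction from the positions of the poles of subdiamonds, whose heights
(distances from the bottom of the diamond) are consecutive multiples of a power of two.

Two points of the diamond either lie on a monotone geodesic or lie on two sides of a subdiamond, so
that crossing between the sides must use a pole (`InfiniteDiamond.dist_eq_or_separates`). Hence the
image of a nearly extremal edge, or of its first or last subedge, is almost monotone: its ends
differ in height by almost `K` times its length (`Separates.monotone_step`,
`exists_almost_monotone`).

Inside such an edge, the two middle points `a`, `b` of the replacement have images of almost equal
height which are nevertheless far apart, so they are separated by poles. The two paths from `p` to
`a` and `b` diverge at a definite rate, yet both must pass near the lower pole; so the height of `f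
p` is close to that of the lower pole, and likewise for `f q` and the upper pole
(`Separates.near_poles`).

This applies both to the quadrilateral of the edge and to the quadrilateral of its first subedge. In
units of `K` times the length of an edge two levels down, they occupy heights 4 to 12 and 1 to 3
above the start. Thus the two powers of two are about 8 and 2, so their ratio is exactly 4, and the
lower poles differ by a multiple of the smaller power. But the difference is about 3, which is one
and a half times that power (`false_of_near_dyadic`). -/

/-! ### Separation by a pair of poles in a metric space with a height function -/

section Poles

variable {M : Type*} [MetricSpace M]

/-- The distance from `x` to `y` is realized through `s` or through `t`. -/
def PassesThrough (s t x y : M) : Prop :=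
  dist x s + dist s y ≤ dist x y ∨ dist x t + dist t y ≤ dist x y

/-- The point `x` lies above `s` and below `t`, with distances given by height differences. -/
def HeightBetween (h : M → ℝ) (s x t : M) : Prop :=
  dist s x = h x - h s ∧ dist x t = h t - h x

/-- The points `y` and `y'` lie on two sides of the poles `s` and `t`: leaving either side,
or crossing from one side to the other, is only possible through a pole. -/
structure Separates (h : M → ℝ) (y y' s t : M) : Prop where
  left : HeightBetween h s y t
  right : HeightBetween h s y' t
  via_left : ∀ z, PassesThrough s t z y ∨ HeightBetween h s z t
  via_right : ∀ z, PassesThrough s t z y' ∨ HeightBetween h s z t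
  via_cross : ∀ z z', PassesThrough s t z y' ∨ PassesThrough s t z' y ∨ PassesThrough s t z z'

theorem PassesThrough.swap {s t x y : M} (H : PassesThrough s t x y) : PassesThrough t s x y :=
  H.symm

theorem HeightBetween.neg {h : M → ℝ} {s x t : M} (H : HeightBetween h s x t) :
    HeightBetween (fun z => -h z) t x s := by
  obtain ⟨h1, h2⟩ := H
  constructor
  · rw [dist_comm, h2]; ring
  · rw [dist_comm, h1]; ring

theorem Separates.neg {h : M → ℝ} {y y' s t : M} (H : Separates h y y' s t) :
    Separates (fun z => -h z) y y' t s where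
  left := H.left.neg
  right := H.right.neg
  via_left z := (H.via_left z).imp PassesThrough.swap HeightBetween.neg
  via_right z := (H.via_right z).imp PassesThrough.swap HeightBetween.neg
  via_cross z z' := (H.via_cross z z').imp PassesThrough.swap
    (Or.imp PassesThrough.swap PassesThrough.swap)

/-! ### Almost monotone geodesics and poles -/

/-- If `x` almost lies on a monotone geodesic towards `y`, at the height of the pole `s`, then it is
close to `s`. -/
theorem dist_pole_le {h : M → ℝ} (hh : ∀ x y, h x - h y ≤ dist x y) {y s t x : M} {ℓ κ δ τ α : ℝ}
    (hvia : PassesThrough s t x y ∨ HeightBetween h s x t) (hy : HeightBetween h s y t)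
    (hsmall : 2 * δ < κ * ℓ) (hty : κ * ℓ - δ / 2 ≤ h t - h y) (hyα : α + ℓ - δ ≤ h y)
    (hs : h s = α + τ) (hx : h x ≤ α + τ + δ) (hxy : dist x y ≤ ℓ - τ + δ) :
    dist x s ≤ 2 * δ := by
  -- A passage through `s` leaves at most `2 * δ` for `dist x s`, because `s` is already at distance
  -- at least `ℓ - τ - δ` from `y`. A passage through `t` overshoots `y` and is too long. Between
  -- the poles, `dist s x` is a height difference of at most `δ`.
  rcases hvia with (h1 | h1) | h1
  · have := hy.1
    linarith [hh y x]
  · have := hy.2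
    have := hh t x
    have := hh t y
    rw [dist_comm t y] at *
    rw [dist_comm t x] at *
    linarith
  · have := hh y x
    rw [dist_comm y x] at this
    rw [dist_comm, h1.1]
    have := hh x s
    linarith [hh y x]

/-- The point `P` cannot be much above `s`, since at least one of the ways from `P` to `y` and `y'`
goes through a pole. It cannot be much below `s` either: both paths would then pass close to `s` at
that height, although they have already diverged. -/
theorem Separates.near_bottom {h : M → ℝ} (hh : ∀ x y, h x - h y ≤ dist x y) {y y' s t P : M}
    (H : Separates h y y' s t) {ℓ κ δ : ℝ} (hκ : 0 < κ) (hκ1 : κ ≤ 1) (hδ : 0 < δ)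
    (hsmall : 2 * δ < κ * ℓ) (hyy : 2 * (κ * ℓ) ≤ dist y y')
    (hPy : dist P y ≤ ℓ) (hPy' : dist P y' ≤ ℓ) (hy : h P + ℓ - δ ≤ h y) (hy' : h P + ℓ - δ ≤ h y')
    (hpath : ∀ τ, 0 ≤ τ → τ ≤ ℓ → ∃ x x', dist P x ≤ τ + δ ∧ dist x y ≤ ℓ - τ + δ ∧
      dist P x' ≤ τ + δ ∧ dist x' y' ≤ ℓ - τ + δ ∧ 2 * (κ * (τ - δ)) ≤ dist x x') :
    κ * |h P - h s| ≤ 3 * δ := by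
  obtain ⟨l1, l2⟩ := H.left
  obtain ⟨r1, r2⟩ := H.right
  have hκδ : κ * δ ≤ δ := by nlinarith
  have hκℓ : κ * ℓ ≤ ℓ := by nlinarith
  have hhy := hh y P
  have hhy' := hh y' P
  rw [dist_comm y] at hhy
  rw [dist_comm y'] at hhy'
  have htri := dist_triangle y t y'
  rw [dist_comm t y'] at htri
  -- The heights of `y` and `y'` differ by at most `δ`, and the route from `y` to `y'` via `t` has
  -- length at least `2 * (κ * ℓ)`; so `t` is well above both.
  have hty : κ * ℓ - δ / 2 ≤ h t - h y := by linarith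
  have hty' : κ * ℓ - δ / 2 ≤ h t - h y' := by linarith
  have hPs := hh P s
  have hPt := hh t P
  rw [dist_comm t P] at hPt
  have hys : 0 ≤ h y - h s := l1 ▸ dist_nonneg
  -- Taking both points of `via_cross` equal to `P`: either `P` is a pole, or the way to `y` or to
  -- `y'` uses one. Reaching `y` or `y'` through `t` would exceed the length `ℓ`.
  have key : h P - h s ≤ δ := by
    rcases H.via_cross P P with (h1 | h1) | (h1 | h1) | (h1 | h1)
    · linarith
    · rw [dist_comm t y'] at h1; linarith
    · linarith
    · rw [dist_comm t y] at h1; linarith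
    · rw [dist_comm s P, dist_self] at h1; linarith
    · rw [dist_comm t P, dist_self] at h1; linarith
  rcases le_total (h s) (h P) with hc | hc
  · rw [abs_of_nonneg (by linarith)]
    nlinarith
  -- At parameter `τ = h s - h P` both paths are within `2 * δ` of `s`, hence `2 * κ * (τ - δ) ≤ 4 *
  -- δ`.
  · obtain ⟨x, x', a1, a2, b1, b2, c⟩ := hpath (h s - h P) (by linarith) (by linarith)
    have ax := hh x P
    have bx := hh x' P
    rw [dist_comm x P] at ax
    rw [dist_comm x' P] at bx
    have e1 := dist_pole_le hh (H.via_left x) H.left hsmall hty hy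
      (show h s = h P + (h s - h P) by ring) (by linarith) a2
    have e2 := dist_pole_le hh (H.via_right x') H.right hsmall hty' hy'
      (show h s = h P + (h s - h P) by ring) (by linarith) b2
    have := dist_triangle_right x x' s
    rw [abs_of_nonpos (by linarith)]
    nlinarith

/-- Two points `y`, `y'` halfway on two almost monotone geodesics from `P` to `Q` which stay apart
from each other: then `P` and `Q` are close to the poles separating `y` and `y'`. -/
theorem Separates.near_poles {h : M → ℝ} (hh : ∀ x y, h x - h y ≤ dist x y) {y y' s t P Q : M}
    (H : Separates h y y' s t) {ℓ κ δ : ℝ} (hκ : 0 < κ) (hκ1 : κ ≤ 1) (hδ : 0 < δ)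
    (hsmall : 2 * δ < κ * ℓ) (hyy : 2 * (κ * ℓ) ≤ dist y y')
    (hPy : dist P y ≤ ℓ) (hPy' : dist P y' ≤ ℓ) (hQy : dist Q y ≤ ℓ) (hQy' : dist Q y' ≤ ℓ)
    (hPQ : 2 * ℓ - δ ≤ h Q - h P)
    (hpath : ∀ τ, 0 ≤ τ → τ ≤ ℓ → ∃ x x', dist P x ≤ τ + δ ∧ dist x y ≤ ℓ - τ + δ ∧
      dist P x' ≤ τ + δ ∧ dist x' y' ≤ ℓ - τ + δ ∧ 2 * (κ * (τ - δ)) ≤ dist x x')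
    (hpath' : ∀ τ, 0 ≤ τ → τ ≤ ℓ → ∃ x x', dist Q x ≤ τ + δ ∧ dist x y ≤ ℓ - τ + δ ∧
      dist Q x' ≤ τ + δ ∧ dist x' y' ≤ ℓ - τ + δ ∧ 2 * (κ * (τ - δ)) ≤ dist x x') :
    κ * |h P - h s| ≤ 3 * δ ∧ κ * |h Q - h t| ≤ 3 * δ := by
  have h1 := hh Q y
  have h2 := hh Q y'
  have h3 := hh y P
  have h4 := hh y' P
  rw [dist_comm] at h3 h4
  constructor
  · exact H.near_bottom hh hκ hκ1 hδ hsmall hyy hPy hPy' (by linarith) (by linarith) hpath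
  -- Turning the space upside down exchanges the poles, and `P` with `Q`.
  · have := H.neg.near_bottom (P := Q) (fun x y => by have := hh y x; rw [dist_comm]; linarith)
      hκ hκ1 hδ hsmall hyy hQy hQy' (by linarith) (by linarith) hpath'
    rwa [neg_sub_neg, abs_sub_comm] at this

/-- An almost geodesic path `y, w, w', y'` with steps `L, 2L, L` is almost monotone on its first or
on its last step. -/
theorem Separates.monotone_step {h : M → ℝ} (hh : ∀ x y, h x - h y ≤ dist x y)
    {y y' s t w w' : M} (H : Separates h y y' s t) {L η : ℝ} (hη : η < 2 * L)
    (hη0 : 0 ≤ η)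
    (h1 : dist y w ≤ L) (h2 : dist w w' ≤ 2 * L) (h3 : dist w' y' ≤ L)
    (h4 : 4 * L - η ≤ dist y y') :
    L - 2 * η ≤ |h w - h y| ∨ L - 2 * η ≤ |h y' - h w'| := by
  obtain ⟨l1, l2⟩ := H.left
  obtain ⟨r1, r2⟩ := H.right
  have t1 := dist_triangle y s y'
  have t2 := dist_triangle y t y'
  have t3 := dist_triangle w w' y'
  have t4 := dist_triangle y w w'
  have hws := hh w s
  have hwt := hh t w
  have hws' := hh w' s
  have hwt' := hh t w'
  have a1 := le_abs_self (h w - h y)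
  have a2 := neg_le_abs (h w - h y)
  have b1 := le_abs_self (h y' - h w')
  have b2 := neg_le_abs (h y' - h w')
  have c1 := dist_comm s y
  have c2 := dist_comm t y
  have c3 := dist_comm s y'
  have c4 := dist_comm t y'
  have c5 := dist_comm s w
  have c6 := dist_comm t w
  have c7 := dist_comm s w'
  have c8 := dist_comm t w'
  have c9 := dist_comm y w
  have c10 := dist_comm w' y
  have d1 := dist_triangle y s w'
  have d2 := dist_triangle y t w'
  have d3 := dist_triangle w s y'
  have d4 := dist_triangle w t y'
  have d5 := dist_triangle y w y'
  have d6 := dist_triangle y w' y'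
  -- The pole used from `w` to `y'` also gives a route from `y` to `y'` of length at least `4 * L -
  -- η`; comparing the two shows that `w` is nearer to this pole in height than `y` by almost `L`.
  have upleft : PassesThrough s t w y' → L - 2 * η ≤ |h w - h y| := by
    rintro (h | h) <;> linarith
  have upright : PassesThrough s t w' y → L - 2 * η ≤ |h y' - h w'| := by
    rintro (h | h) <;> linarith
  by_cases hl : PassesThrough s t w y'
  · exact .inl (upleft hl)
  by_cases hr : PassesThrough s t w' y
  · exact .inr (upright hr)
  -- What remains is that `w` is on the side of `y'` and `w'` on the side of `y`, so each of the
  -- three steps uses a pole. Two successive steps using the same pole force the point between them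
  -- to be close to it, which makes the first or last step monotone. Strictly alternating poles
  -- would run once around both sides, whose total length bounds the distance of `y` and `y'`.
  have hcross := ((H.via_cross w w').resolve_left hl).resolve_left hr
  have hw := (H.via_right w).resolve_left hl
  have hw' := (H.via_left w').resolve_left hr
  have hwy : PassesThrough s t w y := by
    rcases (H.via_cross w w).resolve_left hl with h | h
    · exact h
    · rcases h with h | h
      · rw [dist_self] at h; left; linarith [dist_triangle s w y]
      · rw [dist_self] at h; right; linarith [dist_triangle t w y]
  have hwy' : PassesThrough s t w' y' := by
    rcases H.via_cross w' w' with h | h | h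
    · exact h
    · exact absurd h hr
    · rcases h with h | h
      · rw [dist_self] at h; left; linarith [dist_triangle s w' y']
      · rw [dist_self] at h; right; linarith [dist_triangle t w' y']
  obtain ⟨u1, u2⟩ := hw
  obtain ⟨v1, v2⟩ := hw'
  rcases hwy with e1 | e1 <;> rcases hcross with e2 | e2 <;> rcases hwy' with e3 | e3
  · left; linarith
  · left; linarith
  · exfalso; linarith
  · right; linarith
  · right; linarith
  · exfalso; linarith
  · left; linarith
  · left; linarith

end Poles

/-! ### Heights and poles in graphs -/

section Heights

variable {V : Type} {G : SimpleGraph V} {h : V → ℤ}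

/-- A function on the vertices changing by exactly one along each edge. -/
def IsHeight (G : SimpleGraph V) (h : V → ℤ) : Prop :=
  ∀ x y, G.Adj x y → h y = h x + 1 ∨ h x = h y + 1

/-- There is a geodesic going upwards from `x` to `y`. -/
def IsBelow (G : SimpleGraph V) (h : V → ℤ) (x y : V) : Prop :=
  (G.dist x y : ℤ) = h y - h x

/-- An edge whose upper end is `y`. -/
def IsUpEdge (G : SimpleGraph V) (h : V → ℤ) (x y : V) : Prop :=
  G.Adj x y ∧ h y = h x + 1

/-- A set of vertices between the poles `s` and `t`, which can only be left through the poles. -/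
structure IsSide (G : SimpleGraph V) (h : V → ℤ) (s t : V) (A : Set V) : Prop where
  bottom_mem : s ∈ A
  top_mem : t ∈ A
  below : ∀ x ∈ A, IsBelow G h s x ∧ IsBelow G h x t
  closed : ∀ x ∈ A, x ≠ s → x ≠ t → ∀ y, G.Adj x y → y ∈ A

/-! ### Monotone paths and sides -/

theorem IsHeight.sub_le_length (hh : IsHeight G h) {x y : V} (p : G.Walk x y) :
    h y - h x ≤ p.length := by
  induction p with
  | nil => simp
  | cons a p ih =>
    rw [SimpleGraph.Walk.length_cons]
    rcases hh _ _ a with h1 | h1 <;> push_cast <;> linarith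

theorem IsHeight.sub_le_dist (hh : IsHeight G h) (hG : G.Connected) (x y : V) :
    h y - h x ≤ G.dist x y := by
  obtain ⟨p, hp⟩ := hG.exists_walk_length_eq_dist x y
  rw [← hp]
  exact hh.sub_le_length p

theorem IsHeight.isBelow_of_dist_le (hh : IsHeight G h) (hG : G.Connected) {x y : V}
    (hxy : (G.dist x y : ℤ) ≤ h y - h x) : IsBelow G h x y :=
  le_antisymm hxy (hh.sub_le_dist hG x y)

theorem IsBelow.refl (x : V) : IsBelow G h x x := by simp [IsBelow]

theorem IsUpEdge.isBelow {x y : V} (hxy : IsUpEdge G h x y) : IsBelow G h x y := by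
  rw [IsBelow, SimpleGraph.dist_eq_one_iff_adj.2 hxy.1, hxy.2]
  simp

theorem IsBelow.trans (hh : IsHeight G h) (hG : G.Connected) {x y z : V}
    (h1 : IsBelow G h x y) (h2 : IsBelow G h y z) : IsBelow G h x z := by
  refine hh.isBelow_of_dist_le hG ?_
  have := hG.dist_triangle (u := x) (v := y) (w := z)
  rw [IsBelow] at h1 h2
  zify at this
  linarith

theorem IsHeight.exists_isUpEdge (hh : IsHeight G h) {x y : V} (hxy : G.Adj x y) :
    ∃ a b, IsUpEdge G h a b ∧ s(x, y) = s(a, b) := by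
  rcases hh _ _ hxy with h1 | h1
  · exact ⟨x, y, ⟨hxy, h1⟩, rfl⟩
  · exact ⟨y, x, ⟨hxy.symm, h1⟩, Sym2.eq_swap⟩

/-- A path leaving a side passes through one of its poles. -/
theorem IsSide.dist_add_dist_le {s t : V} {A : Set V} (hA : IsSide G h s t A) (hG : G.Connected)
    {x z : V} (hx : x ∈ A) (hz : z ∉ A) :
    G.dist x s + G.dist s z ≤ G.dist x z ∨ G.dist x t + G.dist t z ≤ G.dist x z := by
  have key : ∀ {x z : V} (p : G.Walk x z), x ∈ A → z ∉ A →
      G.dist x s + G.dist s z ≤ p.length ∨ G.dist x t + G.dist t z ≤ p.length := by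
    intro x z p
    induction p with
    | nil => exact fun h1 h2 => absurd h1 h2
    | @cons x w z a p ih =>
      intro hx hz
      by_cases h1 : x = s
      · subst h1
        left
        simpa using SimpleGraph.dist_le (SimpleGraph.Walk.cons a p)
      by_cases h2 : x = t
      · subst h2
        right
        simpa using SimpleGraph.dist_le (SimpleGraph.Walk.cons a p)
      have hxw := SimpleGraph.dist_eq_one_iff_adj.2 a
      have t1 := hG.dist_triangle (u := x) (v := w) (w := s)
      have t2 := hG.dist_triangle (u := x) (v := w) (w := t)
      rw [SimpleGraph.Walk.length_cons]
      rcases ih (hA.closed x hx h1 h2 w a) hz with h3 | h3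
      · left; omega
      · right; omega
  obtain ⟨p, hp⟩ := hG.exists_walk_length_eq_dist x z
  rw [← hp]
  exact key p hx hz

/-- Two sides between the same poles, which are consecutive points of height divisible
by `2 ^ k`. -/
structure IsSidePair (G : SimpleGraph V) (h : V → ℤ) (s t : V) (k : ℕ) (j : ℤ)
    (A B : Set V) : Prop where
  left : IsSide G h s t A
  right : IsSide G h s t B
  inter : ∀ x ∈ A, x ∈ B → x = s ∨ x = t
  pos : 0 < k
  height_bottom : h s = j * 2 ^ k
  height_top : h t = (j + 1) * 2 ^ k

/-- Any two distinct edges lie above one another or on two sides between the same poles. -/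
def EdgesSplit (G : SimpleGraph V) (h : V → ℤ) : Prop :=
  ∀ x y x' y', IsUpEdge G h x y → IsUpEdge G h x' y' →
    (x = x' ∧ y = y') ∨ IsBelow G h y x' ∨ IsBelow G h y' x ∨
      ∃ s t k j A B, IsSidePair G h s t k j A B ∧ x ∈ A ∧ y ∈ A ∧ x' ∈ B ∧ y' ∈ B

/-! ### Replacing edges by quadrilaterals -/

/-- The height on the subdivided graph. -/
def diamondHeight (h : V → ℤ) : DiamondVertex G → ℤ
  | .old v => 2 * h v
  | .mid e _ => Sym2.lift ⟨fun x y => h x + h y, fun x y => add_comm (h x) (h y)⟩ e.1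

theorem IsUpEdge.diamondHeight_mid {x y : V} (hxy : IsUpEdge G h x y) (i : Bool) :
    diamondHeight (G := G) h (.mid ⟨s(x, y), hxy.1⟩ i) = 2 * h x + 1 := by
  change h x + h y = _
  rw [hxy.2]; ring

theorem IsHeight.exists_mid_eq (hh : IsHeight G h) (e : G.edgeSet) (i : Bool) :
    ∃ x y, ∃ hxy : IsUpEdge G h x y,
      DiamondVertex.mid e i = .mid (G := G) ⟨s(x, y), hxy.1⟩ i := by
  obtain ⟨e, he⟩ := e
  induction e with
  | h x y =>
    obtain ⟨a, b, hab, h1⟩ := hh.exists_isUpEdge he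
    exact ⟨a, b, hab, by congr⟩

theorem IsUpEdge.lower {x y : V} (hxy : IsUpEdge G h x y) (i : Bool) :
    IsUpEdge (diamondReplace G) (diamondHeight h) (.old x) (.mid ⟨s(x, y), hxy.1⟩ i) :=
  ⟨Sym2.mem_mk_left x y, hxy.diamondHeight_mid i⟩

theorem IsUpEdge.upper {x y : V} (hxy : IsUpEdge G h x y) (i : Bool) :
    IsUpEdge (diamondReplace G) (diamondHeight h) (.mid ⟨s(x, y), hxy.1⟩ i) (.old y) :=
  ⟨Sym2.mem_mk_right x y, by
    rw [hxy.diamondHeight_mid]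
    change 2 * h y = _
    rw [hxy.2]; ring⟩

theorem IsHeight.adj_old_mid (hh : IsHeight G h) {w : V} {e : G.edgeSet} {i : Bool}
    (hw : w ∈ e.1) :
    ∃ x y, ∃ hxy : IsUpEdge G h x y, e = ⟨s(x, y), hxy.1⟩ ∧ (w = x ∨ w = y) := by
  obtain ⟨x, y, hxy, he⟩ := hh.exists_mid_eq e i
  injection he with he
  subst he
  exact ⟨x, y, hxy, rfl, Sym2.mem_iff.1 hw⟩

theorem IsHeight.diamondReplace (hh : IsHeight G h) :
    IsHeight (diamondReplace G) (diamondHeight h) := by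
  have key : ∀ (w : V) (e : G.edgeSet) (i : Bool), w ∈ e.1 →
      diamondHeight (G := G) h (.mid e i) = diamondHeight (G := G) h (.old w) + 1 ∨
      diamondHeight (G := G) h (.old w) = diamondHeight (G := G) h (.mid e i) + 1 := by
    intro w e i hw
    obtain ⟨x, y, hxy, rfl, rfl | rfl⟩ := hh.adj_old_mid (i := i) hw
    · exact .inl (hxy.lower i).2
    · exact .inr (hxy.upper i).2
  rintro (w | ⟨e, i⟩) (w' | ⟨e', i'⟩) ha
  · exact ha.elim
  · exact key w e' i' ha
  · exact (key w' e i ha).symm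
  · exact ha.elim

theorem IsHeight.exists_of_isUpEdge_diamond (hh : IsHeight G h) {a b : DiamondVertex G}
    (hab : IsUpEdge (_root_.diamondReplace G) (diamondHeight h) a b) :
    ∃ x y, ∃ hxy : IsUpEdge G h x y, ∃ i,
      (a = .old x ∧ b = .mid ⟨s(x, y), hxy.1⟩ i) ∨ (a = .mid ⟨s(x, y), hxy.1⟩ i ∧ b = .old y) := by
  obtain ⟨ha, hb⟩ := hab
  rcases a with w | ⟨e, i⟩ <;> rcases b with w' | ⟨e', i'⟩
  · exact ha.elim
  · obtain ⟨x, y, hxy, rfl, rfl | rfl⟩ := hh.adj_old_mid (i := i') ha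
    · exact ⟨w, y, hxy, i', .inl ⟨rfl, rfl⟩⟩
    · have := (hxy.upper i').2
      omega
  · obtain ⟨x, y, hxy, rfl, rfl | rfl⟩ := hh.adj_old_mid (i := i) ha
    · have := (hxy.lower i).2
      omega
    · exact ⟨x, w', hxy, i, .inr ⟨rfl, rfl⟩⟩
  · exact ha.elim

theorem IsBelow.diamondReplace (hG : G.Connected) {x y : V} (hxy : IsBelow G h x y) :
    IsBelow (diamondReplace G) (diamondHeight h) (.old x) (.old y) := by
  rw [IsBelow] at *
  rw [diamondReplace_dist hG]
  push_cast
  change _ = 2 * h y - 2 * h x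
  rw [hxy]; ring

/-- The descendants of a set of vertices. -/
def diamondSet (A : Set V) : Set (DiamondVertex G)
  | .old v => v ∈ A
  | .mid e _ => ∀ v ∈ e.1, v ∈ A

theorem mid_mem_diamondSet {A : Set V} {x y : V} (hxy : G.Adj x y) (i : Bool) (hx : x ∈ A)
    (hy : y ∈ A) : DiamondVertex.mid ⟨s(x, y), hxy⟩ i ∈ diamondSet (G := G) A := by
  intro v hv
  rcases Sym2.mem_iff.1 hv with rfl | rfl
  exacts [hx, hy]

/-- A new vertex has only the two ends of its edge as neighbours, so no new exits arise. -/
theorem IsSide.diamondReplace (hh : IsHeight G h) (hG : G.Connected) {s t : V} {A : Set V}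
    (hA : IsSide G h s t A) :
    IsSide (diamondReplace G) (diamondHeight h) (.old s) (.old t) (diamondSet A) where
  bottom_mem := hA.bottom_mem
  top_mem := hA.top_mem
  below := by
    have hG' := diamondReplace_connected hG
    rintro (w | ⟨e, i⟩) hw
    · exact ⟨(hA.below w hw).1.diamondReplace hG, (hA.below w hw).2.diamondReplace hG⟩
    · obtain ⟨x, y, hxy, he⟩ := hh.exists_mid_eq e i
      injection he with he
      subst he
      have hx := hw x (Sym2.mem_mk_left x y)
      have hy := hw y (Sym2.mem_mk_right x y)
      exact ⟨((hA.below x hx).1.diamondReplace hG).trans hh.diamondReplace hG'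
          (hxy.lower i).isBelow,
        (hxy.upper i).isBelow.trans hh.diamondReplace hG' ((hA.below y hy).2.diamondReplace hG)⟩
  closed := by
    rintro (w | ⟨e, i⟩) hw hs ht (w' | ⟨e', i'⟩) ha
    · exact ha.elim
    · obtain ⟨e', he'⟩ := e'
      induction e' with
      | h x y =>
        have hs' : w ≠ s := fun h => hs (h ▸ rfl)
        have ht' : w ≠ t := fun h => ht (h ▸ rfl)
        rcases Sym2.mem_iff.1 ha with rfl | rfl
        · exact mid_mem_diamondSet he' i' hw (hA.closed _ hw hs' ht' _ he')
        · exact mid_mem_diamondSet he' i' (hA.closed _ hw hs' ht' _ he'.symm) hw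
    · exact hw w' ha
    · exact ha.elim

/-- Subdivision doubles heights, which raises the exponent `k` and keeps `j`. -/
theorem IsSidePair.diamondReplace (hh : IsHeight G h) (hG : G.Connected) {s t : V} {k : ℕ} {j : ℤ}
    {A B : Set V} (H : IsSidePair G h s t k j A B) :
    IsSidePair (diamondReplace G) (diamondHeight h) (.old s) (.old t) (k + 1) j
      (diamondSet A) (diamondSet B) where
  left := H.left.diamondReplace hh hG
  right := H.right.diamondReplace hh hG
  inter := by
    rintro (w | ⟨⟨e, he⟩, i⟩) h1 h2
    · rcases H.inter w h1 h2 with rfl | rfl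
      exacts [.inl rfl, .inr rfl]
    · exfalso
      -- A new vertex common to both sides would come from an edge joining the poles; as `k` is
      -- positive, their heights differ by at least two.
      have hst : h t = h s + 2 ^ k := by rw [H.height_top, H.height_bottom]; ring
      have hk : (2 : ℤ) ≤ 2 ^ k := le_self_pow₀ (by norm_num) H.pos.ne'
      have hst' : h s + 2 ≤ h t := by rw [hst]; linarith
      clear hst hk
      induction e with
      | h x y =>
        have hx := H.inter x (h1 x (Sym2.mem_mk_left x y)) (h2 x (Sym2.mem_mk_left x y))
        have hy := H.inter y (h1 y (Sym2.mem_mk_right x y)) (h2 y (Sym2.mem_mk_right x y))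
        have hne := (G.mem_edgeSet.1 he).ne
        rcases hx with rfl | rfl <;> rcases hy with rfl | rfl
        · exact hne rfl
        · rcases hh _ _ (G.mem_edgeSet.1 he) with h1 | h1 <;> omega
        · rcases hh _ _ (G.mem_edgeSet.1 he) with h1 | h1 <;> omega
        · exact hne rfl
  pos := Nat.succ_pos k
  height_bottom := by
    change 2 * h s = _
    rw [H.height_bottom]; ring
  height_top := by
    change 2 * h t = _
    rw [H.height_top]; ring

/-- The set consisting of an edge and a middle vertex is a side. -/
theorem IsUpEdge.isSide (hh : IsHeight G h) (hG : G.Connected) {x y : V} (hxy : IsUpEdge G h x y)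
    (i : Bool) :
    IsSide (_root_.diamondReplace G) (diamondHeight h) (.old x) (.old y)
      {.old x, .mid ⟨s(x, y), hxy.1⟩ i, .old y} where
  bottom_mem := by simp
  top_mem := by simp
  below := by
    have h1 := (hxy.lower i).isBelow
    have h2 := (hxy.upper i).isBelow
    have h3 := h1.trans hh.diamondReplace (diamondReplace_connected hG) h2
    rintro v (rfl | rfl | rfl)
    exacts [⟨.refl _, h3⟩, ⟨h1, h2⟩, ⟨h3, .refl _⟩]
  closed := by
    rintro v (rfl | rfl | rfl) h1 h2 (w | e) ha
    · exact absurd rfl h1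
    · exact absurd rfl h1
    · rcases Sym2.mem_iff.1 ha with rfl | rfl <;> simp
    · exact ha.elim
    · exact absurd rfl h2
    · exact absurd rfl h2

/-- This is how side pairs are born: the poles of a new quadrilateral have heights `2 * h x` and `2
* h x + 2`. -/
theorem IsUpEdge.isSidePair (hh : IsHeight G h) (hG : G.Connected) {x y : V}
    (hxy : IsUpEdge G h x y) {i i' : Bool} (hi : i ≠ i') :
    IsSidePair (_root_.diamondReplace G) (diamondHeight h) (.old x) (.old y) 1 (h x)
      {.old x, .mid ⟨s(x, y), hxy.1⟩ i, .old y} {.old x, .mid ⟨s(x, y), hxy.1⟩ i', .old y} where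
  left := hxy.isSide hh hG i
  right := hxy.isSide hh hG i'
  inter := by
    rintro v (rfl | rfl | rfl) h2
    · exact .inl rfl
    · simp [hi] at h2
    · exact .inr rfl
  pos := one_pos
  height_bottom := mul_comm _ _
  height_top := by
    change 2 * h y = _
    rw [hxy.2]; ring

/-- Children of different edges inherit the relation of their parents. Children of one edge are
equal or consecutive if they share the middle vertex, and otherwise lie on the two sides of the new
quadrilateral. -/
theorem EdgesSplit.diamondReplace (hh : IsHeight G h) (hG : G.Connected) (H : EdgesSplit G h) :
    EdgesSplit (diamondReplace G) (diamondHeight h) := by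
  have hh' := hh.diamondReplace
  have hG' := diamondReplace_connected hG
  intro a b a' b' hab hab'
  obtain ⟨x, y, hxy, i, hi⟩ := hh.exists_of_isUpEdge_diamond hab
  obtain ⟨x', y', hxy', i', hi'⟩ := hh.exists_of_isUpEdge_diamond hab'
  have hby : IsBelow (_root_.diamondReplace G) (diamondHeight h) b (.old y) := by
    rcases hi with ⟨-, rfl⟩ | ⟨-, rfl⟩
    exacts [(hxy.upper i).isBelow, .refl _]
  have hby' : IsBelow (_root_.diamondReplace G) (diamondHeight h) b' (.old y') := by
    rcases hi' with ⟨-, rfl⟩ | ⟨-, rfl⟩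
    exacts [(hxy'.upper i').isBelow, .refl _]
  have hxa : IsBelow (_root_.diamondReplace G) (diamondHeight h) (.old x) a := by
    rcases hi with ⟨rfl, -⟩ | ⟨rfl, -⟩
    exacts [.refl _, (hxy.lower i).isBelow]
  have hxa' : IsBelow (_root_.diamondReplace G) (diamondHeight h) (.old x') a' := by
    rcases hi' with ⟨rfl, -⟩ | ⟨rfl, -⟩
    exacts [.refl _, (hxy'.lower i').isBelow]
  rcases H x y x' y' hxy hxy' with ⟨rfl, rfl⟩ | h1 | h1 | ⟨s, t, k, j, A, B, h1, xA, yA, xB, yB⟩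
  · by_cases hii : i = i'
    · subst hii
      rcases hi with ⟨rfl, rfl⟩ | ⟨rfl, rfl⟩ <;> rcases hi' with ⟨rfl, rfl⟩ | ⟨rfl, rfl⟩
      · exact .inl ⟨rfl, rfl⟩
      · exact .inr (.inl (.refl _))
      · exact .inr (.inr (.inl (.refl _)))
      · exact .inl ⟨rfl, rfl⟩
    · refine .inr (.inr (.inr ⟨_, _, _, _, _, _, hxy.isSidePair hh hG hii, ?_⟩))
      rcases hi with ⟨rfl, rfl⟩ | ⟨rfl, rfl⟩ <;> rcases hi' with ⟨rfl, rfl⟩ | ⟨rfl, rfl⟩ <;> simp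
  · exact .inr (.inl (hby.trans hh' hG' ((h1.diamondReplace hG).trans hh' hG' hxa')))
  · exact .inr (.inr (.inl (hby'.trans hh' hG' ((h1.diamondReplace hG).trans hh' hG' hxa))))
  · refine .inr (.inr (.inr ⟨_, _, _, _, _, _, h1.diamondReplace hh hG, ?_⟩))
    have m1 := mid_mem_diamondSet hxy.1 i xA yA
    have m2 := mid_mem_diamondSet hxy'.1 i' xB yB
    rcases hi with ⟨rfl, rfl⟩ | ⟨rfl, rfl⟩ <;> rcases hi' with ⟨rfl, rfl⟩ | ⟨rfl, rfl⟩
    exacts [⟨xA, m1, xB, m2⟩, ⟨xA, m1, m2, yB⟩, ⟨m1, yA, xB, m2⟩, ⟨m1, yA, m2, yB⟩]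

/-- Two vertices are joined by a monotone geodesic or lie on two sides between the same poles. -/
theorem EdgesSplit.dist_eq_or_exists_isSidePair (H : EdgesSplit G h) (hh : IsHeight G h)
    (hG : G.Connected) [Nontrivial V] (u v : V) :
    IsBelow G h u v ∨ IsBelow G h v u ∨
      ∃ s t k j A B, IsSidePair G h s t k j A B ∧ u ∈ A ∧ v ∈ B := by
  have key : ∀ w, ∃ x y, IsUpEdge G h x y ∧ (w = x ∨ w = y) := by
    intro w
    obtain ⟨z, hz⟩ := hG.preconnected.exists_adj_of_nontrivial w
    rcases hh _ _ hz with h1 | h1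
    · exact ⟨w, z, ⟨hz, h1⟩, .inl rfl⟩
    · exact ⟨z, w, ⟨hz.symm, h1⟩, .inr rfl⟩
  obtain ⟨x, y, hxy, hu⟩ := key u
  obtain ⟨x', y', hxy', hv⟩ := key v
  rcases H x y x' y' hxy hxy' with ⟨rfl, rfl⟩ | h1 | h1 | ⟨s, t, k, j, A, B, h1, xA, yA, xB, yB⟩
  · rcases hu with rfl | rfl <;> rcases hv with rfl | rfl
    · exact .inl (.refl _)
    · exact .inl hxy.isBelow
    · exact .inr (.inl hxy.isBelow)
    · exact .inl (.refl _)
  · left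
    have a : IsBelow G h u y := by rcases hu with rfl | rfl; exacts [hxy.isBelow, .refl _]
    have b : IsBelow G h x' v := by rcases hv with rfl | rfl; exacts [.refl _, hxy'.isBelow]
    exact (a.trans hh hG h1).trans hh hG b
  · right; left
    have a : IsBelow G h v y' := by rcases hv with rfl | rfl; exacts [hxy'.isBelow, .refl _]
    have b : IsBelow G h x u := by rcases hu with rfl | rfl; exacts [.refl _, hxy.isBelow]
    exact (a.trans hh hG h1).trans hh hG b
  · refine .inr (.inr ⟨s, t, k, j, A, B, h1, ?_, ?_⟩)
    · rcases hu with rfl | rfl <;> assumption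
    · rcases hv with rfl | rfl <;> assumption

end Heights

/-! ### Heights and poles in the infinite diamond -/

/-- The height of a vertex of the diamond graph. -/
def diamondGraphHeight : ∀ n, (diamondGraph n).V → ℤ
  | 0 => fun b : Bool => if b then 1 else 0
  | n + 1 => diamondHeight (diamondGraphHeight n)

theorem isHeight_diamondGraphHeight : ∀ n, IsHeight (diamondGraph n).G (diamondGraphHeight n)
  | 0 => by
    intro x y hxy
    change Bool at x y
    have hne : x ≠ y := hxy
    change (if y then (1 : ℤ) else 0) = (if x then 1 else 0) + 1 ∨
      (if x then (1 : ℤ) else 0) = (if y then 1 else 0) + 1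
    cases x <;> cases y <;> simp_all
  | n + 1 => (isHeight_diamondGraphHeight n).diamondReplace

theorem edgesSplit_diamondGraph : ∀ n, EdgesSplit (diamondGraph n).G (diamondGraphHeight n)
  | 0 => by
    have key : ∀ x y, IsUpEdge (diamondGraph 0).G (diamondGraphHeight 0) x y →
        x = false ∧ y = true := by
      intro x y hxy
      change Bool at x y
      have h1 : (if y then (1 : ℤ) else 0) = (if x then 1 else 0) + 1 := hxy.2
      rcases x <;> rcases y
      · simp at h1
      · exact ⟨rfl, rfl⟩
      · simp at h1
      · simp at h1
    intro x y x' y' h1 h2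
    obtain ⟨rfl, rfl⟩ := key x y h1
    obtain ⟨rfl, rfl⟩ := key x' y' h2
    exact .inl ⟨rfl, rfl⟩
  | n + 1 => (edgesSplit_diamondGraph n).diamondReplace (isHeight_diamondGraphHeight n)
      (diamondGraph n).conn

/-- The embedding of the diamond graph into the infinite diamond. -/
noncomputable def Diamond.toLimit (n : ℕ) (v : Diamond n) : InfiniteDiamond :=
  Metric.toInductiveLimit Diamond.isometry_incl n v

theorem Diamond.toLimit_incl (n : ℕ) (v : Diamond n) :
    Diamond.toLimit (n + 1) (Diamond.incl n v) = Diamond.toLimit n v :=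
  congrFun (Metric.toInductiveLimit_commute Diamond.isometry_incl n) v

theorem Diamond.dist_toLimit (n : ℕ) (u v : Diamond n) :
    dist (toLimit n u) (toLimit n v) = (2 : ℝ)⁻¹ ^ n * ((diamondGraph n).G.dist u v : ℝ) :=
  (Metric.toInductiveLimit_isometry Diamond.isometry_incl n).dist_eq u v

theorem Diamond.exists_toLimit_eq_of_le {m n : ℕ} (hmn : m ≤ n) (v : Diamond m) :
    ∃ w, toLimit n w = toLimit m v := by
  induction n, hmn using Nat.le_induction with
  | base => exact ⟨v, rfl⟩
  | succ n _ ih =>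
    obtain ⟨w, hw⟩ := ih
    exact ⟨incl n w, (toLimit_incl n w).trans hw⟩

theorem InfiniteDiamond.exists_toLimit_eq (x : InfiniteDiamond) :
    ∃ n v, Diamond.toLimit n v = x := by
  obtain ⟨⟨n, v⟩, h⟩ := Quotient.exists_rep x
  exact ⟨n, v, h⟩

theorem InfiniteDiamond.exists_toLimit_eq_of_le (x : InfiniteDiamond) :
    ∃ m, ∀ n, m ≤ n → ∃ v, Diamond.toLimit n v = x := by
  obtain ⟨m, v, rfl⟩ := x.exists_toLimit_eq
  exact ⟨m, fun n hn => Diamond.exists_toLimit_eq_of_le hn v⟩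

instance Diamond.nontrivial (n : ℕ) : Nontrivial (diamondGraph n).V := by
  have h01 : toLimit 0 false ≠ toLimit 0 true := by
    intro h
    exact Bool.false_ne_true
      ((Metric.toInductiveLimit_isometry Diamond.isometry_incl 0).injective h)
  obtain ⟨a, ha⟩ := exists_toLimit_eq_of_le (Nat.zero_le n) false
  obtain ⟨b, hb⟩ := exists_toLimit_eq_of_le (Nat.zero_le n) true
  refine ⟨a, b, fun hab => h01 ?_⟩
  rw [← ha, ← hb, hab]

/-- The height of a point of the infinite diamond: its distance from the bottom. -/
noncomputable def InfiniteDiamond.height (x : InfiniteDiamond) : ℝ :=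
  dist (Diamond.toLimit 0 false) x

theorem InfiniteDiamond.height_sub_le (x y : InfiniteDiamond) : height x - height y ≤ dist x y := by
  have := dist_triangle_right (Diamond.toLimit 0 false) x y
  have := dist_triangle (Diamond.toLimit 0 false) y x
  rw [dist_comm y x] at this
  simp only [height]
  linarith

/-- Links the metric height in the limit with the integer heights: the bottom has monotone geodesics
to all vertices. -/
theorem Diamond.exists_bottom : ∀ n, ∃ b : Diamond n, toLimit n b = toLimit 0 false ∧
    diamondGraphHeight n b = 0 ∧ ∀ v, IsBelow (diamondGraph n).G (diamondGraphHeight n) b v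
  | 0 => by
    refine ⟨false, rfl, rfl, fun v => ?_⟩
    change Bool at v
    cases v
    · exact .refl _
    · exact IsUpEdge.isBelow ⟨Bool.false_ne_true, rfl⟩
  | n + 1 => by
    obtain ⟨b, h1, h2, h3⟩ := exists_bottom n
    have hh := isHeight_diamondGraphHeight n
    have hG := (diamondGraph n).conn
    refine ⟨incl n b, (toLimit_incl n b).trans h1, ?_, ?_⟩
    · change 2 * diamondGraphHeight n b = 0
      rw [h2, mul_zero]
    · rintro (w | ⟨e, i⟩)
      · exact (h3 w).diamondReplace hG
      · obtain ⟨x, y, hxy, he⟩ := hh.exists_mid_eq e i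
        rw [he]
        exact ((h3 x).diamondReplace hG).trans hh.diamondReplace
          (diamondReplace_connected hG) (hxy.lower i).isBelow

theorem Diamond.height_toLimit (n : ℕ) (v : Diamond n) :
    (toLimit n v).height = (2 : ℝ)⁻¹ ^ n * (diamondGraphHeight n v : ℝ) := by
  obtain ⟨b, h1, h2, h3⟩ := exists_bottom n
  have h4 : ((diamondGraph n).G.dist b v : ℤ) = _ := h3 v
  rw [h2, sub_zero] at h4
  rw [InfiniteDiamond.height, ← h1, dist_toLimit, ← h4]
  norm_cast

theorem Diamond.dist_toLimit_of_isBelow {n : ℕ} {u v : Diamond n}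
    (huv : IsBelow (diamondGraph n).G (diamondGraphHeight n) u v) :
    dist (toLimit n u) (toLimit n v) = (toLimit n v).height - (toLimit n u).height := by
  have h : (((diamondGraph n).G.dist u v : ℤ) : ℝ) = _ := congrArg Int.cast huv
  push_cast at h
  rw [dist_toLimit, height_toLimit, height_toLimit, h]
  ring

/-! ### Separation by poles in the limit -/

/-- The given points of the infinite diamond are, on level `n`, separated by a pair of sides. -/
def Diamond.SeparatedAt (n : ℕ) (Y Y' S T : InfiniteDiamond) : Prop :=
  ∃ y y' s t : Diamond n, toLimit n y = Y ∧ toLimit n y' = Y' ∧ toLimit n s = S ∧ toLimit n t = T ∧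
    ∃ k j A B, IsSidePair (diamondGraph n).G (diamondGraphHeight n) s t k j A B ∧ y ∈ A ∧ y' ∈ B

theorem Diamond.SeparatedAt.succ {n : ℕ} {Y Y' S T : InfiniteDiamond}
    (H : SeparatedAt n Y Y' S T) : SeparatedAt (n + 1) Y Y' S T := by
  obtain ⟨y, y', s, t, rfl, rfl, rfl, rfl, k, j, A, B, h1, h2, h3⟩ := H
  exact ⟨incl n y, incl n y', incl n s, incl n t, toLimit_incl _ _, toLimit_incl _ _,
    toLimit_incl _ _, toLimit_incl _ _, k + 1, j, _, _,
    h1.diamondReplace (isHeight_diamondGraphHeight n) (diamondGraph n).conn, h2, h3⟩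

theorem Diamond.SeparatedAt.mono {m n : ℕ} (hmn : m ≤ n) {Y Y' S T : InfiniteDiamond}
    (H : SeparatedAt m Y Y' S T) : SeparatedAt n Y Y' S T := by
  induction n, hmn using Nat.le_induction with
  | base => exact H
  | succ n _ ih => exact ih.succ

theorem IsSide.heightBetween {n : ℕ} {s t x : Diamond n} {A : Set (Diamond n)}
    (hA : IsSide (diamondGraph n).G (diamondGraphHeight n) s t A) (hx : x ∈ A) :
    HeightBetween InfiniteDiamond.height (Diamond.toLimit n s) (Diamond.toLimit n x)
      (Diamond.toLimit n t) :=
  ⟨Diamond.dist_toLimit_of_isBelow (hA.below x hx).1,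
    Diamond.dist_toLimit_of_isBelow (hA.below x hx).2⟩

theorem IsSide.passesThrough {n : ℕ} {s t x z : Diamond n} {A : Set (Diamond n)}
    (hA : IsSide (diamondGraph n).G (diamondGraphHeight n) s t A) (hx : x ∈ A) (hz : z ∉ A) :
    PassesThrough (Diamond.toLimit n s) (Diamond.toLimit n t) (Diamond.toLimit n z)
      (Diamond.toLimit n x) := by
  rw [PassesThrough, dist_comm _ (Diamond.toLimit n x), dist_comm _ (Diamond.toLimit n x),
    dist_comm _ (Diamond.toLimit n x), dist_comm (Diamond.toLimit n z),
    dist_comm (Diamond.toLimit n z)]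
  simp only [Diamond.dist_toLimit, ← mul_add]
  refine (hA.dist_add_dist_le (diamondGraph n).conn hx hz).imp ?_ ?_ <;>
  · intro h
    refine mul_le_mul_of_nonneg_left ?_ (by positivity)
    rw [add_comm]
    exact_mod_cast h

/-- The points `z`, `z'` may appear only at later levels, so the sides are first carried to a common
level; membership in the sides then decides which alternative holds. -/
theorem Diamond.SeparatedAt.separates {m : ℕ} {Y Y' S T : InfiniteDiamond}
    (H : SeparatedAt m Y Y' S T) : Separates InfiniteDiamond.height Y Y' S T where
  left := by
    obtain ⟨y, y', s, t, rfl, rfl, rfl, rfl, k, j, A, B, h1, h2, h3⟩ := H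
    exact h1.left.heightBetween h2
  right := by
    obtain ⟨y, y', s, t, rfl, rfl, rfl, rfl, k, j, A, B, h1, h2, h3⟩ := H
    exact h1.right.heightBetween h3
  via_left z := by
    obtain ⟨m', hm'⟩ := z.exists_toLimit_eq_of_le
    obtain ⟨z, rfl⟩ := hm' (max m m') (le_max_right _ _)
    obtain ⟨y, y', s, t, rfl, rfl, rfl, rfl, k, j, A, B, h1, h2, h3⟩ := H.mono (le_max_left m m')
    by_cases hz : z ∈ A
    · exact .inr (h1.left.heightBetween hz)
    · exact .inl (h1.left.passesThrough h2 hz)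
  via_right z := by
    obtain ⟨m', hm'⟩ := z.exists_toLimit_eq_of_le
    obtain ⟨z, rfl⟩ := hm' (max m m') (le_max_right _ _)
    obtain ⟨y, y', s, t, rfl, rfl, rfl, rfl, k, j, A, B, h1, h2, h3⟩ := H.mono (le_max_left m m')
    by_cases hz : z ∈ B
    · exact .inr (h1.right.heightBetween hz)
    · exact .inl (h1.right.passesThrough h3 hz)
  via_cross z z' := by
    obtain ⟨a, ha⟩ := z.exists_toLimit_eq_of_le
    obtain ⟨b, hb⟩ := z'.exists_toLimit_eq_of_le
    obtain ⟨z, rfl⟩ := ha (max m (max a b)) (by simp)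
    obtain ⟨z', rfl⟩ := hb (max m (max a b)) (by simp)
    obtain ⟨y, y', s, t, rfl, rfl, rfl, rfl, k, j, A, B, h1, h2, h3⟩ :=
      H.mono (le_max_left m (max a b))
    by_cases hz : z ∈ B
    · by_cases hz' : z' ∈ A
      · right; right
        by_cases hz'' : z ∈ A
        · rcases h1.inter z hz'' hz with rfl | rfl
          · left; simp
          · right; simp
        · exact h1.left.passesThrough hz' hz''
      · exact .inr (.inl (h1.left.passesThrough h2 hz'))
    · exact .inl (h1.right.passesThrough h3 hz)

/-- Two points of the infinite diamond are joined by a monotone geodesic or separated by the poles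
of a subdiamond. -/
theorem InfiniteDiamond.dist_eq_or_separates (Y Y' : InfiniteDiamond) :
    dist Y Y' = |Y.height - Y'.height| ∨ ∃ S T : InfiniteDiamond, ∃ k j : ℤ,
      S.height = j * (2 : ℝ) ^ k ∧ T.height = (j + 1) * (2 : ℝ) ^ k ∧ Separates height Y Y' S T := by
  obtain ⟨a, ha⟩ := Y.exists_toLimit_eq_of_le
  obtain ⟨b, hb⟩ := Y'.exists_toLimit_eq_of_le
  generalize hn : max a b = n
  obtain ⟨y, rfl⟩ := ha n (by simp [← hn])
  obtain ⟨y', rfl⟩ := hb n (by simp [← hn])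
  rcases (edgesSplit_diamondGraph n).dist_eq_or_exists_isSidePair (isHeight_diamondGraphHeight n)
    (diamondGraph n).conn y y' with h | h | ⟨s, t, k, j, A, B, h1, h2, h3⟩
  · left
    have := Diamond.dist_toLimit_of_isBelow h
    rw [abs_sub_comm, ← this, abs_of_nonneg dist_nonneg]
  · left
    have := Diamond.dist_toLimit_of_isBelow h
    rw [← this, abs_of_nonneg dist_nonneg, dist_comm]
  · right
    have hpow : (2 : ℝ) ^ ((k : ℤ) - n) = 2⁻¹ ^ n * 2 ^ k := by
      rw [zpow_sub₀ two_ne_zero, zpow_natCast, zpow_natCast, inv_pow]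
      field_simp
    refine ⟨Diamond.toLimit n s, Diamond.toLimit n t, k - n, j, ?_, ?_,
      Diamond.SeparatedAt.separates ⟨y, y', s, t, rfl, rfl, rfl, rfl, k, j, A, B, h1, h2, h3⟩⟩
    · refine (Diamond.height_toLimit n s).trans ?_
      rw [h1.height_bottom, hpow]
      push_cast
      ring
    · refine (Diamond.height_toLimit n t).trans ?_
      rw [h1.height_top, hpow]
      push_cast
      ring

/-! ### Edges and geodesics in the Laakso space -/

/-- The embedding of the Laakso graph into the Laakso space. -/
noncomputable def Laakso.toLimit (n : ℕ) (v : Laakso n) : LaaksoSpace :=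
  Metric.toInductiveLimit Laakso.isometry_incl n v

theorem Laakso.toLimit_incl (n : ℕ) (v : Laakso n) :
    Laakso.toLimit (n + 1) (Laakso.incl n v) = Laakso.toLimit n v :=
  congrFun (Metric.toInductiveLimit_commute Laakso.isometry_incl n) v

theorem Laakso.dist_toLimit (n : ℕ) (u v : Laakso n) :
    dist (toLimit n u) (toLimit n v) = (4 : ℝ)⁻¹ ^ n * ((laaksoGraph n).G.dist u v : ℝ) :=
  (Metric.toInductiveLimit_isometry Laakso.isometry_incl n).dist_eq u v

theorem Laakso.exists_toLimit_eq_of_le {m n : ℕ} (hmn : m ≤ n) (v : Laakso m) :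
    ∃ w, toLimit n w = toLimit m v := by
  induction n, hmn using Nat.le_induction with
  | base => exact ⟨v, rfl⟩
  | succ n _ ih =>
    obtain ⟨w, hw⟩ := ih
    exact ⟨incl n w, (toLimit_incl n w).trans hw⟩

theorem LaaksoSpace.exists_toLimit_eq_of_le (x : LaaksoSpace) :
    ∃ m, ∀ n, m ≤ n → ∃ v, Laakso.toLimit n v = x := by
  obtain ⟨⟨m, v⟩, rfl⟩ := Quotient.exists_rep x
  exact ⟨m, fun n hn => Laakso.exists_toLimit_eq_of_le hn v⟩

/-- The points `u` and `v` are joined by an edge of the Laakso graph of level `n`. -/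
def LaaksoSpace.IsEdge (n : ℕ) (u v : LaaksoSpace) : Prop :=
  ∃ x y : Laakso n, (laaksoGraph n).G.Adj x y ∧ Laakso.toLimit n x = u ∧ Laakso.toLimit n y = v

namespace LaaksoSpace

theorem IsEdge.symm {n : ℕ} {u v : LaaksoSpace} (h : IsEdge n u v) : IsEdge n v u := by
  obtain ⟨x, y, h1, h2, h3⟩ := h
  exact ⟨y, x, h1.symm, h3, h2⟩

theorem IsEdge.dist_eq {n : ℕ} {u v : LaaksoSpace} (h : IsEdge n u v) :
    dist u v = (4 : ℝ)⁻¹ ^ n := by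
  obtain ⟨x, y, h1, rfl, rfl⟩ := h
  have : (laaksoGraph n).G.dist x y = 1 := SimpleGraph.dist_eq_one_iff_adj.2 h1
  rw [Laakso.dist_toLimit, this]
  simp

theorem exists_isEdge_zero : ∃ u v, IsEdge 0 u v :=
  ⟨_, _, false, true, Bool.false_ne_true, rfl, rfl⟩

/-- The points replacing an edge of the Laakso graph. -/
theorem IsEdge.exists_replacement {n : ℕ} {u v : LaaksoSpace} (h : IsEdge n u v) :
    ∃ p a b q, IsEdge (n + 1) u p ∧ IsEdge (n + 1) p a ∧ IsEdge (n + 1) p b ∧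
      IsEdge (n + 1) a q ∧ IsEdge (n + 1) b q ∧ IsEdge (n + 1) q v ∧
      2 * (4 : ℝ)⁻¹ ^ (n + 1) ≤ dist a b := by
  obtain ⟨x, y, hxy, rfl, rfl⟩ := h
  let G := (laaksoGraph n).G
  let p : LaaksoVertex G := .near ⟨(x, y), hxy⟩
  let q : LaaksoVertex G := .near ⟨(y, x), hxy.symm⟩
  let m : Bool → LaaksoVertex G := fun i => .mid ⟨s(x, y), hxy⟩ i
  have hm : ∀ i, (laaksoReplace G).Adj (m i) q := fun i => Sym2.eq_swap
  refine ⟨Laakso.toLimit (n + 1) p, Laakso.toLimit (n + 1) (m true), Laakso.toLimit (n + 1) (m false),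
    Laakso.toLimit (n + 1) q, ⟨Laakso.incl n x, p, rfl, Laakso.toLimit_incl _ _, rfl⟩,
    ⟨p, m true, rfl, rfl, rfl⟩, ⟨p, m false, rfl, rfl, rfl⟩, ⟨m true, q, hm true, rfl, rfl⟩,
    ⟨m false, q, hm false, rfl, rfl⟩, ⟨q, Laakso.incl n y, rfl, rfl, Laakso.toLimit_incl _ _⟩, ?_⟩
  have hne : m true ≠ m false := by simp [m]
  have hconn : (laaksoReplace G).Connected := laaksoReplace_connected (laaksoGraph n).conn
  have h2 : 1 < (laaksoReplace G).dist (m true) (m false) :=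
    hconn.one_lt_dist_of_ne_of_not_adj hne id
  refine le_of_le_of_eq ?_ (Laakso.dist_toLimit (n + 1) (m true) (m false)).symm
  rw [mul_comm]
  refine mul_le_mul_of_nonneg_left ?_ (by positivity)
  exact_mod_cast h2

/-- A map which is Lipschitz on all edges is Lipschitz. -/
theorem dist_map_le_of_isEdge {M : Type*} [MetricSpace M] (f : LaaksoSpace → M) {K : ℝ}
    (hf : ∀ n u v, IsEdge n u v → dist (f u) (f v) ≤ K * (4 : ℝ)⁻¹ ^ n) (u v : LaaksoSpace) :
    dist (f u) (f v) ≤ K * dist u v := by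
  obtain ⟨a, ha⟩ := u.exists_toLimit_eq_of_le
  obtain ⟨b, hb⟩ := v.exists_toLimit_eq_of_le
  obtain ⟨x, rfl⟩ := ha _ (le_max_left a b)
  obtain ⟨y, rfl⟩ := hb _ (le_max_right a b)
  generalize max a b = n at x y
  have key : ∀ {x y : (laaksoGraph n).V} (p : (laaksoGraph n).G.Walk x y),
      dist (f (Laakso.toLimit n x)) (f (Laakso.toLimit n y)) ≤
        K * ((4 : ℝ)⁻¹ ^ n * p.length) := by
    intro x y p
    induction p with
    | nil => simp
    | @cons x w y e p ih =>
      have h1 := hf n _ _ ⟨x, w, e, rfl, rfl⟩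
      have h2 := dist_triangle (f (Laakso.toLimit n x)) (f (Laakso.toLimit n w))
        (f (Laakso.toLimit n y))
      rw [SimpleGraph.Walk.length_cons]
      push_cast
      linarith
  obtain ⟨p, hp⟩ := (laaksoGraph n).conn.exists_walk_length_eq_dist x y
  have hd : dist (Laakso.toLimit n x) (Laakso.toLimit n y) = (4 : ℝ)⁻¹ ^ n * p.length := by
    rw [hp]
    exact Laakso.dist_toLimit n x y
  rw [hd]
  exact key p

/-- Every edge is filled by points almost at any given distance from its first end. -/
theorem IsEdge.exists_between (k : ℕ) : ∀ {n : ℕ} {u v : LaaksoSpace}, IsEdge n u v →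
    ∀ τ : ℝ, 0 ≤ τ → τ ≤ (4 : ℝ)⁻¹ ^ n →
      ∃ x, dist u x + dist x v = dist u v ∧ |dist u x - τ| ≤ (4 : ℝ)⁻¹ ^ (n + k) := by
  induction k with
  | zero =>
    intro n u v _ τ h0 h1
    exact ⟨u, by simp, by simpa [abs_of_nonneg h0] using h1⟩
  | succ k ih =>
    intro n u v h τ h0 h1
    obtain ⟨p, a, b, q, up, pa, -, aq, -, qv, -⟩ := h.exists_replacement
    generalize hw : (4 : ℝ)⁻¹ ^ (n + 1) = w at *
    have h4 : (4 : ℝ)⁻¹ ^ n = 4 * w := by rw [← hw, pow_succ]; ring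
    have d0 := h.dist_eq
    have d1 := up.dist_eq
    have d2 := pa.dist_eq
    have d3 := aq.dist_eq
    have d4 := qv.dist_eq
    rw [hw] at d1 d2 d3 d4
    -- Here `y`, `z` is a subedge of the geodesic `u, p, a, q, v`, and `c` is the distance of `y`
    -- from `u`.
    have key : ∀ (y z : LaaksoSpace) (c : ℝ), IsEdge (n + 1) y z → dist u y ≤ c →
        dist z v ≤ 3 * w - c → c ≤ τ → τ ≤ c + w →
        ∃ x, dist u x + dist x v = dist u v ∧ |dist u x - τ| ≤ (4 : ℝ)⁻¹ ^ (n + (k + 1)) := by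
      intro y z c hyz e1 e2 e3 e4
      obtain ⟨x, f1, f2⟩ := ih hyz (τ - c) (by linarith) (by rw [hw]; linarith)
      rw [hyz.dist_eq, hw] at f1
      have t1 := dist_triangle u y x
      have t2 := dist_triangle x z v
      have t3 := dist_triangle u x v
      refine ⟨x, by linarith, ?_⟩
      rw [show n + (k + 1) = n + 1 + k by ring]
      have : dist u x = c + dist y x := by linarith
      rw [this]
      convert f2 using 2
      ring
    have t1 := dist_triangle u p a
    have t2 := dist_triangle u a q
    have t3 := dist_triangle a q v
    have t4 := dist_triangle p a v
    rcases le_total τ w with c1 | c1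
    · exact key u p 0 up (by simp) (by linarith) (by linarith) (by linarith)
    rcases le_total τ (2 * w) with c2 | c2
    · exact key p a w pa (by linarith) (by linarith) (by linarith) (by linarith)
    rcases le_total τ (3 * w) with c3 | c3
    · exact key a q (2 * w) aq (by linarith) (by linarith) (by linarith) (by linarith)
    · exact key q v (3 * w) qv (by linarith) (by simp) (by linarith) (by linarith)

end LaaksoSpace

/-! ### Bilipschitz maps of the Laakso space into the infinite diamond -/

namespace LaaksoSpace

variable {f : LaaksoSpace → InfiniteDiamond} {r K : ℝ}

/-- Supplies the diverging paths for `Separates.near_poles`. Since `a` and `b` are two edge lengths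
apart, points on the edges `p a` and `p b` are at least as far apart as the sum of their distances
from `p`. -/
theorem exists_pair_on_edges (hf : ∀ u v, r * dist u v ≤ dist (f u) (f v))
    (hK : ∀ u v, dist (f u) (f v) ≤ K * dist u v) (hr : 0 < r) (hK0 : 0 < K) {n : ℕ}
    {p a b : LaaksoSpace} (pa : IsEdge n p a) (pb : IsEdge n p b)
    (hab : 2 * (4 : ℝ)⁻¹ ^ n ≤ dist a b) {δ : ℝ} (hδ : 0 < δ)
    (τ : ℝ) (h0 : 0 ≤ τ) (h1 : τ ≤ K * (4 : ℝ)⁻¹ ^ n) :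
    ∃ x x', dist (f p) x ≤ τ + δ ∧ dist x (f a) ≤ K * (4 : ℝ)⁻¹ ^ n - τ + δ ∧
      dist (f p) x' ≤ τ + δ ∧ dist x' (f b) ≤ K * (4 : ℝ)⁻¹ ^ n - τ + δ ∧
      2 * (r / K * (τ - δ)) ≤ dist x x' := by
  obtain ⟨k, hk⟩ := exists_pow_lt_of_lt_one (show 0 < δ / K by positivity)
    (show (4 : ℝ)⁻¹ < 1 by norm_num)
  have hk' : (4 : ℝ)⁻¹ ^ (n + k) ≤ δ / K :=
    (pow_le_pow_of_le_one (by norm_num) (by norm_num) (Nat.le_add_left k n)).trans hk.le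
  have key : ∀ c, IsEdge n p c → ∃ x, dist p x + dist x c = (4 : ℝ)⁻¹ ^ n ∧
      τ / K - δ / K ≤ dist p x ∧ dist (f p) (f x) ≤ τ + δ ∧
      dist (f x) (f c) ≤ K * (4 : ℝ)⁻¹ ^ n - τ + δ := by
    intro c hc
    obtain ⟨x, e1, e2⟩ := hc.exists_between k (τ / K) (by positivity)
      (by rw [div_le_iff₀ hK0]; linarith)
    rw [hc.dist_eq] at e1
    obtain ⟨e3, e4⟩ := abs_le.1 (e2.trans hk')
    have e5 : K * dist p x ≤ τ + δ := by
      have : K * dist p x ≤ K * (τ / K + δ / K) := by gcongr; linarith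
      rwa [mul_add, mul_div_cancel₀ _ hK0.ne', mul_div_cancel₀ _ hK0.ne'] at this
    have e6 : τ - δ ≤ K * dist p x := by
      have : K * (τ / K - δ / K) ≤ K * dist p x := by gcongr; linarith
      rwa [mul_sub, mul_div_cancel₀ _ hK0.ne', mul_div_cancel₀ _ hK0.ne'] at this
    refine ⟨x, e1, by linarith, (hK _ _).trans e5, (hK _ _).trans ?_⟩
    rw [← e1, mul_add]
    linarith
  obtain ⟨x, a1, a2, a3, a4⟩ := key a pa
  obtain ⟨x', b1, b2, b3, b4⟩ := key b pb
  refine ⟨f x, f x', a3, a4, b3, b4, le_trans ?_ (hf x x')⟩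
  have t1 := dist_triangle a x b
  have t2 := dist_triangle x x' b
  rw [dist_comm a x] at t1
  have : 2 * (r / K * (τ - δ)) = r * (2 * (τ / K - δ / K)) := by ring
  rw [this]
  gcongr
  linarith

/-- If the image of a quadrilateral of the Laakso graph is almost monotone, then two opposite
vertices are mapped close to the poles of a subdiamond. -/
theorem exists_poles_near (hf : ∀ u v, r * dist u v ≤ dist (f u) (f v))
    (hK : ∀ u v, dist (f u) (f v) ≤ K * dist u v) (hr : 0 < r) (hK0 : 0 < K) (hrK : r ≤ K) {n : ℕ}
    {p a b q : LaaksoSpace} (pa : IsEdge n p a) (pb : IsEdge n p b) (aq : IsEdge n a q)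
    (bq : IsEdge n b q) (hab : 2 * (4 : ℝ)⁻¹ ^ n ≤ dist a b) {δ ℓ : ℝ}
    (hℓ : K * (4 : ℝ)⁻¹ ^ n = ℓ) (hδ : 0 < δ) (hsmall : 2 * δ < r / K * ℓ)
    (hpq : 2 * ℓ - δ ≤ (f q).height - (f p).height) :
    ∃ k j : ℤ, r / K * |(f p).height - j * (2 : ℝ) ^ k| ≤ 3 * δ ∧
      r / K * |(f q).height - (j + 1) * (2 : ℝ) ^ k| ≤ 3 * δ := by
  have hh := InfiniteDiamond.height_sub_le
  have e : ∀ {u v}, IsEdge n u v → dist (f u) (f v) ≤ ℓ := by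
    intro u v h
    rw [← hℓ, ← h.dist_eq]
    exact hK u v
  have hyy : 2 * (r / K * ℓ) ≤ dist (f a) (f b) := by
    refine le_trans ?_ (hf a b)
    rw [← hℓ, ← mul_assoc (r / K), div_mul_cancel₀ _ hK0.ne', mul_left_comm]
    gcongr
  rcases InfiniteDiamond.dist_eq_or_separates (f a) (f b) with h | ⟨S, T, k, j, hS, hT, h⟩
  -- The heights of `f a` and `f b` differ by at most `δ`, whereas their distance exceeds `4 * δ`.
  · exfalso
    have h1 := hh (f q) (f a)
    have h2 := hh (f q) (f b)
    have h3 := hh (f a) (f p)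
    have h4 := hh (f b) (f p)
    have := e pa
    have := e pb
    have := e aq
    have := e bq
    rw [dist_comm] at h1 h2 h3 h4
    have : |(f a).height - (f b).height| ≤ δ := abs_le.2 ⟨by linarith, by linarith⟩
    linarith
  · refine ⟨k, j, ?_⟩
    rw [← hS, ← hT]
    subst hℓ
    exact h.near_poles hh (div_pos hr hK0) ((div_le_one hK0).2 hrK) hδ hsmall hyy
      (e pa) (e pb) (e aq.symm) (e bq.symm) hpq
      (exists_pair_on_edges hf hK hr hK0 pa pb hab hδ)
      (exists_pair_on_edges hf hK hr hK0 aq.symm bq.symm hab hδ)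

/-- Multiples of powers of two cannot be located like the quadrilaterals in the replacement of an
edge and in the replacement of its first subedge. -/
theorem false_of_near_dyadic {P Q P' Q' ℓ ε : ℝ} {k j k' j' : ℤ} (hℓ : 100 * ε = ℓ) (hε : 0 < ε)
    (h1 : |P - j * (2 : ℝ) ^ k| ≤ ε) (h2 : |Q - (j + 1) * (2 : ℝ) ^ k| ≤ ε)
    (h3 : |P' - j' * (2 : ℝ) ^ k'| ≤ ε) (h4 : |Q' - (j' + 1) * (2 : ℝ) ^ k'| ≤ ε)
    (h5 : |Q - P - 8 * ℓ| ≤ ε) (h6 : |Q' - P' - 2 * ℓ| ≤ ε) (h7 : |P - P' - 3 * ℓ| ≤ ε) :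
    False := by
  rw [abs_le] at *
  obtain ⟨h1, h1'⟩ := h1
  obtain ⟨h2, h2'⟩ := h2
  obtain ⟨h3, h3'⟩ := h3
  obtain ⟨h4, h4'⟩ := h4
  obtain ⟨h5, h5'⟩ := h5
  obtain ⟨h6, h6'⟩ := h6
  obtain ⟨h7, h7'⟩ := h7
  -- The powers are within `3 * ε` of `8 * ℓ` and `2 * ℓ`.
  have hk : k = k' + 2 := by
    have a1 : (2 : ℝ) ^ (k' + 1) < 2 ^ k := by
      rw [zpow_add₀ two_ne_zero, zpow_one]
      linarith
    have a2 : (2 : ℝ) ^ k < 2 ^ (k' + 3) := by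
      rw [zpow_add₀ two_ne_zero, show (2 : ℝ) ^ (3 : ℤ) = 8 by norm_num]
      linarith
    rw [zpow_lt_zpow_iff_right₀ one_lt_two] at a1 a2
    omega
  have hpow : (2 : ℝ) ^ k = 4 * 2 ^ k' := by
    rw [hk, zpow_add₀ two_ne_zero, show (2 : ℝ) ^ (2 : ℤ) = 4 by norm_num, mul_comm]
  rw [hpow] at h1 h1' h2 h2'
  have hpos : (0 : ℝ) < 2 ^ k' := by positivity
  -- The lower poles differ by `(4 * j - j') * 2 ^ k'`, which is about `3 * ℓ`, so the integer
  -- factor is about 3/2.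
  have b1 : (1 : ℝ) < (4 * j - j' : ℤ) := by
    refine lt_of_mul_lt_mul_right (a := (2 : ℝ) ^ k') ?_ hpos.le
    push_cast
    linarith
  have b2 : ((4 * j - j' : ℤ) : ℝ) < 2 := by
    refine lt_of_mul_lt_mul_right (a := (2 : ℝ) ^ k') ?_ hpos.le
    push_cast
    linarith
  have b1' : 1 < 4 * j - j' := by exact_mod_cast b1
  have b2' : 4 * j - j' < 2 := by exact_mod_cast b2
  omega

/-- No edge of the Laakso graph has an almost monotone image in the infinite diamond. -/
theorem not_almost_monotone (hf : ∀ u v, r * dist u v ≤ dist (f u) (f v))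
    (hK : ∀ u v, dist (f u) (f v) ≤ K * dist u v) (hr : 0 < r) (hK0 : 0 < K) (hrK : r ≤ K) {n : ℕ}
    {u v : LaaksoSpace} (huv : IsEdge n u v) :
    (f v).height - (f u).height < (K - r / 5000) * (4 : ℝ)⁻¹ ^ n := by
  by_contra! hcon
  obtain ⟨p, a, b, q, up, pa, pb, aq, bq, qv, hab⟩ := huv.exists_replacement
  obtain ⟨p', a', b', q', up', pa', pb', aq', bq', qp', hab'⟩ := up.exists_replacement
  obtain ⟨ℓ, hℓ⟩ : ∃ ℓ, K * (4 : ℝ)⁻¹ ^ (n + 2) = ℓ := ⟨_, rfl⟩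
  have hℓ0 : 0 < ℓ := by rw [← hℓ]; positivity
  have hℓ1 : K * (4 : ℝ)⁻¹ ^ (n + 1) = 4 * ℓ := by rw [← hℓ, pow_succ _ (n + 1)]; ring
  have hℓ2 : K * (4 : ℝ)⁻¹ ^ n = 16 * ℓ := by rw [← hℓ, pow_add]; norm_num; ring
  have hκ : 0 < r / K := div_pos hr hK0
  have hκ1 : r / K ≤ 1 := (div_le_one hK0).2 hrK
  -- With this `δ`, the error `3 * δ` divided by `r / K` is `ℓ / 100`, and the allowed deficit `r /
  -- 5000` amounts to less than `δ`.
  obtain ⟨δ, hδ⟩ : ∃ δ, r / K * (ℓ / 300) = δ := ⟨_, rfl⟩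
  have hδ0 : 0 < δ := by rw [← hδ]; positivity
  have hδℓ : δ ≤ ℓ / 300 := by
    rw [← hδ]
    exact mul_le_of_le_one_left (by positivity) hκ1
  have hmain : 16 * ℓ - δ ≤ (f v).height - (f u).height := by
    refine le_trans ?_ hcon
    have e1 : r * (4 : ℝ)⁻¹ ^ n = r / K * (16 * ℓ) := by
      rw [← hℓ2, ← mul_assoc, div_mul_cancel₀ _ hK0.ne']
    have e2 : (K - r / 5000) * (4 : ℝ)⁻¹ ^ n = 16 * ℓ - r / K * (16 * ℓ) / 5000 := by
      rw [← e1, ← hℓ2]; ring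
    have e3 : r / K * (16 * ℓ) / 5000 = δ * (16 * 300 / 5000) := by rw [← hδ]; ring
    rw [e2, e3]
    linarith
  -- No step can rise by more than `K` times its length, so every part of the path from `u` to `v`
  -- misses its maximal rise by at most `δ`.
  have hstep : ∀ {m x y}, IsEdge m x y → (f y).height - (f x).height ≤ K * (4 : ℝ)⁻¹ ^ m := by
    intro m x y h
    rw [← h.dist_eq, dist_comm x y]
    exact (InfiniteDiamond.height_sub_le _ _).trans (hK _ _)
  have s1 := hstep up
  have s2 := hstep pa
  have s3 := hstep aq
  have s4 := hstep qv
  have s1' := hstep up'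
  have s2' := hstep pa'
  have s3' := hstep aq'
  have s4' := hstep qp'
  rw [hℓ1] at s1 s2 s3 s4
  rw [hℓ] at s1' s2' s3' s4'
  have hκℓ : r / K * ℓ = 300 * δ := by rw [← hδ]; ring
  obtain ⟨k, j, A1, A2⟩ := exists_poles_near hf hK hr hK0 hrK pa pb aq bq hab hℓ1 hδ0
    (by linarith) (by linarith)
  obtain ⟨k', j', B1, B2⟩ := exists_poles_near hf hK hr hK0 hrK pa' pb' aq' bq' hab' hℓ hδ0
    (by linarith) (by linarith)
  have hdiv : ∀ x, r / K * x ≤ 3 * δ → x ≤ ℓ / 100 := by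
    intro x hx
    refine le_of_mul_le_mul_left (hx.trans (le_of_eq ?_)) hκ
    rw [← hδ]; ring
  exact false_of_near_dyadic (ℓ := ℓ) (ε := ℓ / 100) (by ring) (by positivity)
    (hdiv _ A1) (hdiv _ A2) (hdiv _ B1) (hdiv _ B2) (abs_le.2 ⟨by linarith, by linarith⟩)
    (abs_le.2 ⟨by linarith, by linarith⟩) (abs_le.2 ⟨by linarith, by linarith⟩)

/-- An edge which is stretched almost as much as possible yields an edge with almost monotone
image. -/
theorem exists_almost_monotone
    (hK : ∀ u v, dist (f u) (f v) ≤ K * dist u v) (hK0 : 0 < K) {ε : ℝ} (hε : 0 < ε)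
    (hεK : 2 * ε < K) {n : ℕ} {u v : LaaksoSpace} (huv : IsEdge n u v)
    (hstretch : (K - ε) * (4 : ℝ)⁻¹ ^ n ≤ dist (f u) (f v)) :
    ∃ m x y, IsEdge m x y ∧ (K - 8 * ε) * (4 : ℝ)⁻¹ ^ m ≤ (f y).height - (f x).height := by
  suffices h : ∃ m x y, IsEdge m x y ∧
      (K - 8 * ε) * (4 : ℝ)⁻¹ ^ m ≤ |(f y).height - (f x).height| by
    obtain ⟨m, x, y, h1, h2⟩ := h
    rcases le_abs.1 h2 with h3 | h3
    · exact ⟨m, x, y, h1, h3⟩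
    · exact ⟨m, y, x, h1.symm, by linarith⟩
  have hw : (0 : ℝ) < (4 : ℝ)⁻¹ ^ (n + 1) := by positivity
  have hw' : (4 : ℝ)⁻¹ ^ n = 4 * (4 : ℝ)⁻¹ ^ (n + 1) := by rw [pow_succ]; ring
  rcases InfiniteDiamond.dist_eq_or_separates (f u) (f v) with h | ⟨S, T, k, j, -, -, h⟩
  · refine ⟨n, u, v, huv, ?_⟩
    rw [abs_sub_comm, ← h]
    refine le_trans ?_ hstretch
    gcongr
    linarith
  · obtain ⟨p, a, b, q, up, pa, -, aq, -, qv, -⟩ := huv.exists_replacement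
    have t := dist_triangle p a q
    have d1 := hK u p
    have d2 := hK p q
    have d3 := hK q v
    rw [up.dist_eq] at d1
    rw [pa.dist_eq, aq.dist_eq] at t
    rw [qv.dist_eq] at d3
    have d2' : K * dist p q ≤ K * (2 * (4 : ℝ)⁻¹ ^ (n + 1)) := by
      gcongr
      linarith
    rw [hw'] at hstretch
    have hεw := mul_lt_mul_of_pos_right hεK hw
    have hεw' : 0 < ε * (4 : ℝ)⁻¹ ^ (n + 1) := by positivity
    -- The deficit `η` is `ε` times the length of the whole edge, that is, `4 * ε` per subedge
    -- length; the loss of `2 * η` is the source of the factor 8.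
    rcases h.monotone_step InfiniteDiamond.height_sub_le (L := K * (4 : ℝ)⁻¹ ^ (n + 1))
      (η := 4 * (ε * (4 : ℝ)⁻¹ ^ (n + 1))) (w := f p) (w' := f q)
      (by linarith) (by linarith) d1 (by linarith) d3 (by linarith) with h1 | h1
    · exact ⟨n + 1, u, p, up, by linarith⟩
    · exact ⟨n + 1, q, v, qv, by linarith⟩

end LaaksoSpace

theorem corollary2 : ¬ ∃ f : LaaksoSpace → InfiniteDiamond, IsBilipschitzEmbedding f := by
  rintro ⟨f, C, -, r, hr, hf⟩
  -- The supremum of the edge stretches is a global Lipschitz constant by summing along walks, and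
  -- is almost attained on an edge.
  let s : Set ℝ := {x | ∃ n u v, LaaksoSpace.IsEdge n u v ∧
    x = dist (f u) (f v) / (4 : ℝ)⁻¹ ^ n}
  have hs : BddAbove s := by
    refine ⟨r * C, ?_⟩
    rintro _ ⟨n, u, v, h, rfl⟩
    rw [div_le_iff₀ (by positivity), ← h.dist_eq]
    exact (hf u v).2
  obtain ⟨u₀, v₀, h₀⟩ := LaaksoSpace.exists_isEdge_zero
  have hrs : r ≤ sSup s := by
    refine le_trans ?_ (le_csSup hs ⟨0, u₀, v₀, h₀, rfl⟩)
    rw [le_div_iff₀ (by positivity), ← h₀.dist_eq]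
    exact (hf u₀ v₀).1
  have hK : ∀ u v, dist (f u) (f v) ≤ sSup s * dist u v := by
    refine LaaksoSpace.dist_map_le_of_isEdge f fun n u v h => ?_
    rw [← div_le_iff₀ (by positivity)]
    exact le_csSup hs ⟨n, u, v, h, rfl⟩
  -- The slack satisfies `8 * (r / 40000) = r / 5000`, the deficit excluded by
  -- `not_almost_monotone`.
  obtain ⟨_, ⟨n, u, v, h, rfl⟩, hlt⟩ :=
    exists_lt_of_lt_csSup (s := s) ⟨_, 0, u₀, v₀, h₀, rfl⟩
      (show sSup s - r / 40000 < sSup s by linarith)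
  rw [lt_div_iff₀ (by positivity)] at hlt
  obtain ⟨m, x, y, hxy, hmono⟩ := LaaksoSpace.exists_almost_monotone hK (by linarith)
    (show 0 < r / 40000 by positivity) (by linarith) h hlt.le
  have := LaaksoSpace.not_almost_monotone (fun u v => (hf u v).1) hK hr (by linarith) hrs hxy
  rw [show sSup s - 8 * (r / 40000) = sSup s - r / 5000 by ring] at hmono
  linarith
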